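/- Let $d\ge 1$ be an integer, let $(A,\mathfrak m)$ be an Artinian local ring with infinite residue field, let $S=\bigoplus_{\mathbf n\in\mathbb N^d}S_{\mathbf n}$ be a finitely generated standard $\mathbb N^d$-graded $A$-algebra (i.e. generated over $A$ by finitely many elements of total degree $1$), and let $M=\bigoplus_{\mathbf n\in\mathbb N^d}M_{\mathbf n}$ be a finitely generated $\mathbb N^d$-graded $S$-module. Order $\mathbb N^d$ componentwise; "for $\mathbf n\gg\mathbf 0$" means for all $\mathbf n\ge\mathbf n_0$ for some $\mathbf n_0\in\mathbb N^d$; $\ell_A$ denotes length. Let $\mathbf e_i$ be the $i$-th unit vector of $\mathbb N^d$, $S_i=S_{\mathbf e_i}$, and $S_{++}=\bigoplus_{\mathbf n\ge(1,\dots,1)}S_{\mathbf n}$. For a finitely generated $\mathbb N^d$-graded $S$-module $N$ let $\mathrm{Supp}_{++}N$ be the set of homogeneous prime ideals $P$ of $S$ with $S_{++}\not\subseteq P$ and $N_P\neq0$, and let $\dim\mathrm{Supp}_{++}N$ be the supremum of the lengths of chains of primes in it ($-\infty$ if it is empty). The function $\mathbf n\mapsto\ell_A(M_{\mathbf n})$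 is finite and agrees for $\mathbf n\gg\mathbf 0$ with a polynomial $P_M\in\mathbb Q[n_1,\dots,n_d]$, which can be written as $$P_M(\mathbf n)=\sum_{\mathbf h\in\mathbb N^d}e(M;\mathbf h)\prod_{i=1}^d\binom{n_i+h_i}{h_i},\qquad e(M;\mathbf h)\in\mathbb Z,$$ with only finitely many $e(M;\mathbf h)\ne 0$. For $\mathbf k\in\mathbb N^d$, the mixed multiplicity (of maximal degree) of $M$ of the type $\mathbf k$ is said to be defined if $e(M;\mathbf h)=0$ for all $\mathbf h\geq\mathbf k$ with $\mathbf h\neq\mathbf k$; it is then the integer $e(M;\mathbf k)$. A mixed multiplicity system of $M$ of the type $\mathbf k=(k_1,\dots,k_d)$ is a sequence $\mathbf x=x_1,\dots,x_r$ consisting of $k_1$ elements of $S_1$, …, $k_d$ elements of $S_d$ (in any order) such that $\dim\mathrm{Supp}_{++}(M/\mathbf xM)\le 0$. For such $\mathbf x$ let $H_i(\mathbf x,M)$ be the $i$-th Koszul homology module, with the grading for which the Koszul differentials are homogeneous of degree $\mathbf 0$ (the basis element corresponding to $x_j\in S_i$ having degree $\mathbf e_i$), and let $$\chi(\mathbf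 x,M)=\sum_{i=0}^r(-1)^i\ell_A\big(H_i(\mathbf x,M)_{\mathbf n}\big)\quad\text{for }\mathbf n\gg\mathbf 0 .$$ The mixed multiplicity symbol $\widetilde e(\mathbf x,M)$ is defined recursively: if $r=0$, it is the constant value of $\ell_A(M_{\mathbf n})$ for $\mathbf n\gg\mathbf 0$; if $r>0$, then $$\widetilde e(\mathbf x,M)=\widetilde e(\mathbf x',M/x_1M)-\widetilde e(\mathbf x',0_M:x_1),\qquad \mathbf x'=x_2,\dots,x_r,$$ where $0_M:x_1=\{m\in M: x_1m=0\}$. Theorem. For every $\mathbf k\in\mathbb N^d$, the mixed multiplicity of maximal degree of $M$ of the type $\mathbf k$ is defined if and only if there exists a mixed multiplicity system of $M$ of the type $\mathbf k$. In this case, for every mixed multiplicity system $\mathbf x$ of $M$ of the type $\mathbf k$, the numbers $\chi(\mathbf x,M)$ and $\widetilde e(\mathbf x,M)$ are well defined (the alternating sum above is constant for $\mathbf n\gg\mathbf 0$, and so is the length function at every end of the recursion), and $$\chi(\mathbf x,M)=\widetilde e(\mathbf x,M)=e(M;\mathbf k).$$ -/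

import Mathlib

open Filter

noncomputable section

namespace MixedMult

universe u v w

/-! ### The relevant support and its dimension -/

section Support

variable {d : ℕ} {A : Type u} {S : Type v} [CommRing A] [CommRing S] [Algebra A S]

/-- `S` is a finitely generated standard `ℕ^d`-graded algebra over `A`: a finitely generated
`A`-algebra that is generated by its elements of total degree one. -/
def IsStandardGraded (𝒮 : (Fin d → ℕ) → Submodule A S) : Prop :=
  Algebra.FiniteType A S ∧
    Algebra.adjoin A (⋃ i : Fin d, (𝒮 (Pi.single i 1) : Set S)) = ⊤

/-- The ideal `S_{++} = ⨁_{n ≥ (1,…,1)} S_n`. -/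
def relevantIdeal (𝒮 : (Fin d → ℕ) → Submodule A S) : Ideal S :=
  Ideal.span (⋃ (n : Fin d → ℕ) (_ : 1 ≤ n), (𝒮 n : Set S))

/-- `Supp_{++} M`: the homogeneous primes `P` of `S` with `S_{++} ⊄ P` and `M_P ≠ 0`. -/
def relevantSupport (𝒮 : (Fin d → ℕ) → Submodule A S) [GradedAlgebra 𝒮]
    (M : Type w) [AddCommGroup M] [Module S M] : Set (PrimeSpectrum S) :=
  {P | P.asIdeal.IsHomogeneous 𝒮 ∧ ¬ relevantIdeal 𝒮 ≤ P.asIdeal ∧ P ∈ Module.support S M}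

/-- `dim Supp_{++} M`: the supremum of the lengths of chains of primes in `Supp_{++} M`; it is
`⊥` (that is, `-∞`) if `Supp_{++} M` is empty. -/
def dimRelevantSupport (𝒮 : (Fin d → ℕ) → Submodule A S) [GradedAlgebra 𝒮]
    (M : Type w) [AddCommGroup M] [Module S M] : WithBot ℕ∞ :=
  Order.krullDim (relevantSupport 𝒮 M)

/-- `x 0, …, x (r-1)` is a mixed multiplicity system of `M` of the type `k`, where `x j` is
regarded as an element of `S_{c j}` (the index `c j` is recorded because the zero element lies in
every `S_i`): exactly `k i` of the elements are taken from `S_i`, for each `i`, and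
`dim Supp_{++} (M / x M) ≤ 0`. -/
def IsMixedMultiplicitySystem (𝒮 : (Fin d → ℕ) → Submodule A S) [GradedAlgebra 𝒮]
    (M : Type w) [AddCommGroup M] [Module S M] {r : ℕ} (x : Fin r → S) (c : Fin r → Fin d)
    (k : Fin d → ℕ) : Prop :=
  (∀ j, x j ∈ 𝒮 (Pi.single (c j) 1)) ∧
  (∀ i, (Finset.univ.filter fun j => c j = i).card = k i) ∧
  dimRelevantSupport 𝒮 (M ⧸ (Ideal.span (Set.range x) • (⊤ : Submodule S M))) ≤ 0

end Support

/-! ### The Hilbert polynomial and its coefficients -/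

section Hilbert

variable {d : ℕ} (A : Type u) {M : Type w} [CommRing A] [AddCommGroup M] [Module A M]

/-- `P` is the Hilbert polynomial of the family `ℳ`: for all large `n` the length of `ℳ n` is
finite and equal to `P(n)`. -/
def IsHilbertPolynomial (ℳ : (Fin d → ℕ) → Submodule A M) (P : MvPolynomial (Fin d) ℚ) : Prop :=
  ∀ᶠ n : Fin d → ℕ in atTop, Module.length A (ℳ n) ≠ ⊤ ∧
    ((Module.length A (ℳ n)).toNat : ℚ) = MvPolynomial.eval (fun i => (n i : ℚ)) P

open Classical in
/-- The Hilbert polynomial `P_M`. -/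
def hilbertPolynomial (ℳ : (Fin d → ℕ) → Submodule A M) : MvPolynomial (Fin d) ℚ :=
  if h : ∃ P, IsHilbertPolynomial A ℳ P then h.choose else 0

/-- The polynomial `binom(n+k, k) = ∏ i, (n_i + 1) ⋯ (n_i + k_i) / k_i!`. -/
def binomialPolynomial (k : Fin d → ℕ) : MvPolynomial (Fin d) ℚ :=
  ∏ i, (MvPolynomial.C (((k i).factorial : ℚ)⁻¹) *
    ∏ j ∈ Finset.range (k i), (MvPolynomial.X i + MvPolynomial.C ((j : ℚ) + 1)))

/-- `P = ∑ k, e k * binom(n+k, k)`. -/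
def IsBinomialExpansion (P : MvPolynomial (Fin d) ℚ) (e : (Fin d → ℕ) →₀ ℤ) : Prop :=
  P = e.sum fun k a => MvPolynomial.C (a : ℚ) * binomialPolynomial k

open Classical in
/-- The integers `e(M; k)` in `P_M(n) = ∑ k, e(M; k) * binom(n+k, k)`. -/
def hilbertCoeff (ℳ : (Fin d → ℕ) → Submodule A M) : (Fin d → ℕ) →₀ ℤ :=
  if h : ∃ e, IsBinomialExpansion (hilbertPolynomial A ℳ) e then h.choose else 0

/-- The mixed multiplicity (of maximal degree) of the type `k` is defined:
`e(M; h) = 0` for all `h > k` (that is, `h ≥ k` componentwise and `h ≠ k`). -/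
def MixedMultiplicityDefined (ℳ : (Fin d → ℕ) → Submodule A M) (k : Fin d → ℕ) : Prop :=
  ∀ h, k < h → hilbertCoeff A ℳ h = 0

open Classical in
/-- The constant value that a function on `ℕ^d` takes for all large `n` (`0` if there is none). -/
def eventualValue (f : (Fin d → ℕ) → ℤ) : ℤ :=
  if h : ∃ a, ∀ᶠ n in atTop, f n = a then h.choose else 0

end Hilbert

/-! ### The Koszul complex and the Euler–Poincaré characteristic -/

section Koszul

variable {d : ℕ} (A : Type u) {S : Type v} {M : Type w} [CommRing A] [CommRing S] [Algebra A S]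
  [AddCommGroup M] [Module A M] [Module S M] [IsScalarTower A S M]

/-- The total Koszul complex of `M` with respect to `x` is `⨁_I M e_I`, `I` a subset of the index
set. An element is the function `I ↦ m_I` of its coordinates. The differential is
`m e_I ↦ ∑_{j ∈ I} (-1)^{#{l ∈ I | l < j}} x_j m e_{I \ {j}}`; here it is written coordinatewise. -/
def koszulDifferential {r : ℕ} (x : Fin r → S) :
    (Finset (Fin r) → M) →ₗ[S] (Finset (Fin r) → M) :=
  LinearMap.pi fun J => ∑ j ∈ Jᶜ,
    ((-1 : S) ^ (J.filter fun l => l < j).card * x j) • LinearMap.proj (insert j J)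

/-- The degree of `e_I` when `x j` has degree `e_{c j}`. -/
def koszulDegree {r : ℕ} (c : Fin r → Fin d) (I : Finset (Fin r)) : Fin d → ℕ :=
  ∑ j ∈ I, Pi.single (c j) 1

open Classical in
/-- `K_i(x, M)_n`, the component of degree `n` of `K_i(x, M) = ⨁_{|I| = i} M(-deg e_I)`. -/
def koszulComponent (ℳ : (Fin d → ℕ) → Submodule A M) {r : ℕ} (c : Fin r → Fin d)
    (i : ℕ) (n : Fin d → ℕ) : Submodule A (Finset (Fin r) → M) :=
  Submodule.pi Set.univ fun I =>
    if I.card = i ∧ koszulDegree c I ≤ n then ℳ (n - koszulDegree c I) else ⊥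

/-- The cycles in `K_i(x, M)_n`. -/
def koszulCycles (ℳ : (Fin d → ℕ) → Submodule A M) {r : ℕ} (x : Fin r → S) (c : Fin r → Fin d)
    (i : ℕ) (n : Fin d → ℕ) : Submodule A (Finset (Fin r) → M) :=
  koszulComponent A ℳ c i n ⊓ LinearMap.ker ((koszulDifferential x).restrictScalars A)

/-- The boundaries in `K_i(x, M)_n`. -/
def koszulBoundaries (ℳ : (Fin d → ℕ) → Submodule A M) {r : ℕ} (x : Fin r → S)
    (c : Fin r → Fin d) (i : ℕ) (n : Fin d → ℕ) : Submodule A (Finset (Fin r) → M) :=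
  (koszulComponent A ℳ c (i + 1) n).map ((koszulDifferential x).restrictScalars A)

/-- The component `H_i(x, M)_n` of the `i`th Koszul homology module: cycles modulo boundaries. -/
abbrev KoszulHomology (ℳ : (Fin d → ℕ) → Submodule A M) {r : ℕ} (x : Fin r → S)
    (c : Fin r → Fin d) (i : ℕ) (n : Fin d → ℕ) : Type w :=
  koszulCycles A ℳ x c i n ⧸
    (koszulBoundaries A ℳ x c i n).submoduleOf (koszulCycles A ℳ x c i n)

/-- `∑_{i=0}^r (-1)^i ℓ_A[H_i(x, M)_n]`. -/
def koszulEulerFunction (ℳ : (Fin d → ℕ) → Submodule A M) {r : ℕ} (x : Fin r → S)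
    (c : Fin r → Fin d) (n : Fin d → ℕ) : ℤ :=
  ∑ i ∈ Finset.range (r + 1),
    (-1) ^ i * ((Module.length A (KoszulHomology A ℳ x c i n)).toNat : ℤ)

/-- The Euler–Poincaré characteristic is well defined: for all large `n` the lengths
`ℓ_A[H_i(x, M)_n]` are finite and their alternating sum is independent of `n`. -/
def EulerCharDefined (ℳ : (Fin d → ℕ) → Submodule A M) {r : ℕ} (x : Fin r → S)
    (c : Fin r → Fin d) : Prop :=
  (∀ᶠ n in atTop, ∀ i, Module.length A (KoszulHomology A ℳ x c i n) ≠ ⊤) ∧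
  ∃ a, ∀ᶠ n in atTop, koszulEulerFunction A ℳ x c n = a

/-- The Euler–Poincaré characteristic `χ(x, M)`. -/
def eulerChar (ℳ : (Fin d → ℕ) → Submodule A M) {r : ℕ} (x : Fin r → S)
    (c : Fin r → Fin d) : ℤ :=
  eventualValue (koszulEulerFunction A ℳ x c)

end Koszul

/-! ### The mixed multiplicity symbol -/

section Symbol

variable {d : ℕ} (A : Type u) {S : Type v} [CommRing A] [CommRing S] [Algebra A S]

/-- The grading of `M / a M` induced by the grading `ℳ` of `M`. -/
def quotGrading {M : Type w} [AddCommGroup M] [Module A M] [Module S M] [IsScalarTower A S M]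
    (a : S) (ℳ : (Fin d → ℕ) → Submodule A M) :
    (Fin d → ℕ) → Submodule A (M ⧸ (Ideal.span {a} • (⊤ : Submodule S M))) :=
  fun n => (ℳ n).map ((Ideal.span {a} • (⊤ : Submodule S M)).mkQ.restrictScalars A)

/-- The grading of `0_M : a` induced by the grading `ℳ` of `M`. -/
def annGrading {M : Type w} [AddCommGroup M] [Module A M] [Module S M] [IsScalarTower A S M]
    (a : S) (ℳ : (Fin d → ℕ) → Submodule A M) :
    (Fin d → ℕ) → Submodule A (Submodule.torsionBy S M a) :=
  fun n => (ℳ n).comap ((Submodule.torsionBy S M a).subtype.restrictScalars A)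

/-- The mixed multiplicity symbol `ẽ(x, M)`: for the empty sequence it is the constant value of
`ℓ_A[M_n]` for large `n`, and otherwise `ẽ(x, M) = ẽ(x', M / x₁ M) - ẽ(x', 0_M : x₁)`, where
`x'` is `x` without its first element `x₁`. -/
def mixedSymbol : (r : ℕ) → (x : Fin r → S) → (M : Type w) → [AddCommGroup M] → [Module A M] →
    [Module S M] → [IsScalarTower A S M] → ((Fin d → ℕ) → Submodule A M) → ℤ
  | 0, _, _, _, _, _, _, ℳ => eventualValue fun n => ((Module.length A (ℳ n)).toNat : ℤ)
  | r + 1, x, M, _, _, _, _, ℳ =>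
      mixedSymbol r (Fin.tail x) (M ⧸ (Ideal.span {x 0} • (⊤ : Submodule S M)))
          (quotGrading A (x 0) ℳ) -
        mixedSymbol r (Fin.tail x) (Submodule.torsionBy S M (x 0)) (annGrading A (x 0) ℳ)

/-- The mixed multiplicity symbol is well defined: at every end of the recursion the lengths of
the graded components are finite and constant for large `n`. -/
def MixedSymbolDefined : (r : ℕ) → (x : Fin r → S) → (M : Type w) → [AddCommGroup M] →
    [Module A M] → [Module S M] → [IsScalarTower A S M] → ((Fin d → ℕ) → Submodule A M) → Prop
  | 0, _, _, _, _, _, _, ℳ => ∃ a : ℕ, ∀ᶠ n in atTop, Module.length A (ℳ n) = a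
  | r + 1, x, M, _, _, _, _, ℳ =>
      MixedSymbolDefined r (Fin.tail x) (M ⧸ (Ideal.span {x 0} • (⊤ : Submodule S M)))
          (quotGrading A (x 0) ℳ) ∧
        MixedSymbolDefined r (Fin.tail x) (Submodule.torsionBy S M (x 0)) (annGrading A (x 0) ℳ)

end Symbol

end MixedMult

end

/-!
The Hilbert function of a finitely generated graded module `M` over a standard graded algebra is
eventually a numerical polynomial, written in the basis `∏ i, binom(n_i + h_i, h_i)` with integer
coefficients `e(M; h)`. In this basis the backward difference in the direction `i` is the shift
`e(h) ↦ e(h + e_i)` of the coefficients (`EventuallyBinomial.backwardDiff`), and this drives the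
whole proof.

*Hilbert functions.* Everything about them is obtained by graded dévissage (`devissage`): by
Noetherian induction a property that is compatible with the exact sequences
`0 → (S / (N : m))(-a) → M / N → M / (N + S m) → 0` has to be checked only for `S / P` with `P` a
homogeneous prime in the support. If `S_i ⊆ P` for some `i`, the Hilbert function of `S / P` is
eventually zero; otherwise its difference in the direction `i` is the Hilbert function of
`S / (P + x S)` with `x ∈ S_i \ P`. This yields the existence of the Hilbert polynomial
(`IsStandardGraded.exists_eventuallyBinomial`), and that it is constant if
`dim Supp_{++} M ≤ 0` (`IsStandardGraded.eventually_const`). Conversely, for a chain `P < Q` in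
`Supp_{++} M` the Hilbert function of `S / P` is unbounded, while it is dominated by that of `M`
(`IsStandardGraded.relevantDimNonpos_of_eventually_const`).

*Systems and symbols.* For `x ∈ S_i` the sequence `0 → (0_M : x)(-e_i) → M(-e_i) → M → M/xM → 0`
gives `e(M; h + e_i) = e(M/xM; h) - e(0_M : x; h) + e(0_M : x; h + e_i)` (`coeff_add_single`).
If `x₁, …, x_r` is a system of type `k` of `M`, then `x₂, …, x_r` is one of `M/x₁M` and of
`0_M : x₁`; induction on `r` gives `e(M; h) = 0` for `h > k` and `ẽ(x, M) = e(M; k)`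
(`IsStandardGraded.mixedSymbol_eq`). Conversely, a filter-regular `x ∈ S_i`, which exists because
the residue field is infinite, satisfies `e(M/xM; h) = e(M; h + e_i)`, so that successive
filter-regular elements form a system of type `k` as soon as `e(M; h) = 0` for all `h > k`
(`IsStandardGraded.exists_system`).

*Euler–Poincaré characteristic.* The alternating sum of the lengths of the Koszul homology equals
that of the Koszul complex, which is the iterated difference of type `k` of the Hilbert function.
Its coefficients are `e(M; h + k)`, so it is the constant `e(M; k)` (`eulerChar_eq`).
-/

open Filter
noncomputable section
namespace MixedMult
universe u v w

/-! ### Numerical polynomials in the binomial basis -/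

section Binomial

variable {d : ℕ}

/-- A property of vectors of natural numbers that holds for `0` and the unit vectors and is stable
under addition holds for all vectors. -/
theorem vector_induction {Q : (Fin d → ℕ) → Prop} (h0 : Q 0)
    (hadd : ∀ v w, Q v → Q w → Q (v + w)) (hs : ∀ i, Q (Pi.single i 1)) (v : Fin d → ℕ) : Q v := by
  let T : AddSubmonoid (Fin d → ℕ) :=
    { carrier := {v | Q v}, zero_mem' := h0, add_mem' := fun {a b} ha hb => hadd a b ha hb }
  have hv : v = ∑ i, v i • (Pi.single i 1 : Fin d → ℕ) := by
    ext j
    simp [Finset.sum_apply, Pi.single_apply]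
  have : v ∈ T := by
    rw [hv]
    exact T.sum_mem fun i _ => T.nsmul_mem (hs i) _
  exact this

theorem exists_eq_add_single {i : Fin d} {g : Fin d → ℕ} (hg : g i ≠ 0) :
    ∃ g' : Fin d → ℕ, g = g' + Pi.single i 1 := by
  refine ⟨g - Pi.single i 1, (tsub_add_cancel_of_le fun j => ?_).symm⟩
  by_cases hj : j = i
  · subst hj
    simpa using Nat.one_le_iff_ne_zero.mpr hg
  · simp [hj]

theorem eventually_ge_vector {p : (Fin d → ℕ) → Prop} (h : ∀ᶠ n in atTop, p n) :
    ∃ n₀, ∀ n, n₀ ≤ n → p n := eventually_atTop.mp h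

theorem tendsto_sub_vector (v : Fin d → ℕ) :
    Tendsto (fun n : Fin d → ℕ => n - v) atTop atTop :=
  tendsto_atTop.2 fun b => (eventually_ge_atTop (b + v)).mono fun n hn => by
    rw [← add_tsub_cancel_right b v]
    exact tsub_le_tsub_right hn v

/-- The value at `n` of `∏ i, binom(n i + h i, h i)`. -/
def binomialValue (h n : Fin d → ℕ) : ℤ := ∏ i, ((n i + h i).choose (h i) : ℤ)

@[simp] theorem binomialValue_zero (n : Fin d → ℕ) : binomialValue 0 n = 1 := by
  simp [binomialValue]

/-- The value at `n` of `∑ h, e h * ∏ i, binom(n i + h i, h i)`. -/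
def binomialSum (e : (Fin d → ℕ) →₀ ℤ) (n : Fin d → ℕ) : ℤ :=
  e.sum fun h a => a * binomialValue h n

theorem binomialSum_add (e e' : (Fin d → ℕ) →₀ ℤ) (n : Fin d → ℕ) :
    binomialSum (e + e') n = binomialSum e n + binomialSum e' n :=
  Finsupp.sum_add_index' (by simp) (by intros; ring)

@[simp] theorem binomialSum_single (h : Fin d → ℕ) (a : ℤ) (n : Fin d → ℕ) :
    binomialSum (Finsupp.single h a) n = a * binomialValue h n := by
  simp [binomialSum]

@[simp] theorem binomialSum_zero (n : Fin d → ℕ) : binomialSum 0 n = 0 := by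
  simp [binomialSum]

theorem binomialSum_sub (e e' : (Fin d → ℕ) →₀ ℤ) (n : Fin d → ℕ) :
    binomialSum (e - e') n = binomialSum e n - binomialSum e' n := by
  rw [eq_sub_iff_add_eq, ← binomialSum_add, sub_add_cancel]

/-- The coefficient family `h ↦ e (h + v)`. -/
def coeffShift (v : Fin d → ℕ) (e : (Fin d → ℕ) →₀ ℤ) : (Fin d → ℕ) →₀ ℤ :=
  e.comapDomain (· + v) (add_left_injective v).injOn

@[simp] theorem coeffShift_apply (v : Fin d → ℕ) (e : (Fin d → ℕ) →₀ ℤ) (h : Fin d → ℕ) :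
    coeffShift v e h = e (h + v) := rfl

theorem coeffShift_add (v : Fin d → ℕ) (e e' : (Fin d → ℕ) →₀ ℤ) :
    coeffShift v (e + e') = coeffShift v e + coeffShift v e' := by
  ext; simp

theorem coeffShift_zero (e : (Fin d → ℕ) →₀ ℤ) : coeffShift 0 e = e := by
  ext; simp

theorem coeffShift_coeffShift (v w : Fin d → ℕ) (e : (Fin d → ℕ) →₀ ℤ) :
    coeffShift v (coeffShift w e) = coeffShift (v + w) e := by
  ext; simp [add_assoc]

theorem coeffShift_single_add (v h : Fin d → ℕ) (a : ℤ) :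
    coeffShift v (Finsupp.single (h + v) a) = Finsupp.single h a := by
  classical
  ext g
  simp [Finsupp.single_apply]

theorem coeffShift_single_of_not_le {v h : Fin d → ℕ} (hv : ¬ v ≤ h) (a : ℤ) :
    coeffShift v (Finsupp.single h a) = 0 := by
  classical
  ext g
  have : h ≠ g + v := fun hh => hv (hh ▸ le_add_self)
  simp [this]

theorem binomialValue_sub_of_eq_zero (i : Fin d) (h n : Fin d → ℕ) (hi : h i = 0) :
    binomialValue h (n - Pi.single i 1) = binomialValue h n := by
  refine Finset.prod_congr rfl fun j _ => ?_
  by_cases hj : j = i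
  · subst hj; simp [hi]
  · simp [hj]

/-- Pascal's rule for the backward difference in the direction `i`. -/
theorem binomialValue_add_single (i : Fin d) (h n : Fin d → ℕ) (hn : 1 ≤ n i) :
    binomialValue (h + Pi.single i 1) n - binomialValue (h + Pi.single i 1) (n - Pi.single i 1) =
      binomialValue h n := by
  simp only [binomialValue]
  rw [← Finset.mul_prod_erase _ _ (Finset.mem_univ i), ← Finset.mul_prod_erase _ _
    (Finset.mem_univ i), ← Finset.mul_prod_erase _ _ (Finset.mem_univ i)]
  have h1 : ∏ j ∈ Finset.univ.erase i,
      ((n j + (h + (Pi.single i 1 : Fin d → ℕ)) j).choose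
        ((h + (Pi.single i 1 : Fin d → ℕ)) j) : ℤ) =
      ∏ j ∈ Finset.univ.erase i, ((n j + h j).choose (h j) : ℤ) :=
    Finset.prod_congr rfl fun j hj => by simp [Finset.ne_of_mem_erase hj]
  have h2 : ∏ j ∈ Finset.univ.erase i,
      (((n - (Pi.single i 1 : Fin d → ℕ)) j + (h + (Pi.single i 1 : Fin d → ℕ)) j).choose
        ((h + (Pi.single i 1 : Fin d → ℕ)) j) : ℤ) =
      ∏ j ∈ Finset.univ.erase i, ((n j + h j).choose (h j) : ℤ) :=
    Finset.prod_congr rfl fun j hj => by simp [Finset.ne_of_mem_erase hj]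
  rw [h1, h2, ← sub_mul]
  congr 1
  obtain ⟨m, hm⟩ := Nat.exists_eq_add_of_le' hn
  simp only [Pi.add_apply, Pi.sub_apply, Pi.single_eq_same, hm, add_tsub_cancel_right]
  rw [show m + 1 + (h i + 1) = (m + 1 + h i) + 1 by ring, Nat.choose_succ_succ,
    show m + (h i + 1) = m + 1 + h i by ring]
  push_cast
  ring

theorem binomialSum_sub_single (e : (Fin d → ℕ) →₀ ℤ) (i : Fin d) (n : Fin d → ℕ)
    (hn : 1 ≤ n i) :
    binomialSum e n - binomialSum e (n - Pi.single i 1) =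
      binomialSum (coeffShift (Pi.single i 1) e) n := by
  induction e using Finsupp.induction_linear with
  | zero =>
    have : coeffShift (Pi.single i 1) (0 : (Fin d → ℕ) →₀ ℤ) = 0 := by ext; simp
    simp [this]
  | add e e' he he' =>
    rw [coeffShift_add, binomialSum_add, binomialSum_add, binomialSum_add, ← he, ← he']
    ring
  | single h a =>
    by_cases hi : h i = 0
    · have hle : ¬ (Pi.single i 1 : Fin d → ℕ) ≤ h := fun hle => by
        have := hle i
        simp [hi] at this
      rw [coeffShift_single_of_not_le hle]
      simp [binomialValue_sub_of_eq_zero i h n hi]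
    · obtain ⟨g, rfl⟩ := exists_eq_add_single hi
      rw [coeffShift_single_add]
      simp only [binomialSum_single]
      rw [← mul_sub, binomialValue_add_single i g n hn]

/-- For all large `n` the function `f` agrees with the numerical polynomial that has the
coefficients `e` in the binomial basis. -/
def EventuallyBinomial (f : (Fin d → ℕ) → ℤ) (e : (Fin d → ℕ) →₀ ℤ) : Prop :=
  ∀ᶠ n in atTop, f n = binomialSum e n

/-- The backward difference of a function in the direction `i`; the subtraction `n - e_i` is
truncated, which matters only for `n i = 0`. -/
def backwardDiff (i : Fin d) (f : (Fin d → ℕ) → ℤ) (n : Fin d → ℕ) : ℤ :=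
  f n - f (n - Pi.single i 1)

theorem eventually_one_le (i : Fin d) : ∀ᶠ n : Fin d → ℕ in atTop, 1 ≤ n i :=
  (eventually_ge_atTop 1).mono fun _ hn => hn i

namespace EventuallyBinomial

variable {f g : (Fin d → ℕ) → ℤ} {e e' : (Fin d → ℕ) →₀ ℤ}

theorem congr (hf : EventuallyBinomial f e) (h : ∀ᶠ n in atTop, g n = f n) :
    EventuallyBinomial g e := by
  filter_upwards [hf, h] with n h1 h2
  rw [h2, h1]

theorem add (hf : EventuallyBinomial f e) (hg : EventuallyBinomial g e') :
    EventuallyBinomial (fun n => f n + g n) (e + e') := by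
  filter_upwards [hf, hg] with n h1 h2
  rw [h1, h2, binomialSum_add]

theorem sub (hf : EventuallyBinomial f e) (hg : EventuallyBinomial g e') :
    EventuallyBinomial (fun n => f n - g n) (e - e') := by
  filter_upwards [hf, hg] with n h1 h2
  rw [h1, h2, binomialSum_sub]

theorem backwardDiff (hf : EventuallyBinomial f e) (i : Fin d) :
    EventuallyBinomial (backwardDiff i f) (coeffShift (Pi.single i 1) e) := by
  filter_upwards [hf, (tendsto_sub_vector (Pi.single i 1)).eventually hf, eventually_one_le i]
    with n h1 h2 h3
  rw [MixedMult.backwardDiff, h1, h2, binomialSum_sub_single _ _ _ h3]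

theorem comp_sub_single (hf : EventuallyBinomial f e) (i : Fin d) :
    EventuallyBinomial (fun n => f (n - Pi.single i 1)) (e - coeffShift (Pi.single i 1) e) :=
  (hf.sub (hf.backwardDiff i)).congr (Eventually.of_forall fun n => by
    simp [MixedMult.backwardDiff])

theorem exists_comp_sub (hf : EventuallyBinomial f e) (v : Fin d → ℕ) :
    ∃ e', EventuallyBinomial (fun n => f (n - v)) e' := by
  revert f e
  induction v using vector_induction with
  | h0 => intro f e hf; exact ⟨e, by simpa using hf⟩
  | hadd v w hv hw =>
    intro f e hf
    obtain ⟨e₁, h₁⟩ := hw hf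
    obtain ⟨e₂, h₂⟩ := hv h₁
    exact ⟨e₂, h₂.congr (Eventually.of_forall fun n => by simp only [tsub_add_eq_tsub_tsub])⟩
  | hs i => intro f e hf; exact ⟨_, hf.comp_sub_single i⟩

theorem eq_zero (h : EventuallyBinomial (fun _ => 0) e) : e = 0 := by
  have key : ∀ v : Fin d → ℕ, ∀ e : (Fin d → ℕ) →₀ ℤ, EventuallyBinomial (fun _ => 0) e →
      EventuallyBinomial (fun _ => 0) (coeffShift v e) := by
    intro v
    induction v using vector_induction with
    | h0 => intro e he; rwa [coeffShift_zero]
    | hadd v w hv hw =>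
      intro e he
      rw [← coeffShift_coeffShift]
      exact hv _ (hw _ he)
    | hs i =>
      intro e he
      exact (he.backwardDiff i).congr (Eventually.of_forall fun n => by
        simp [MixedMult.backwardDiff])
  by_contra hne
  -- Differences in the direction of a maximal exponent leave only its coefficient.
  obtain ⟨m, hm⟩ := Finset.exists_maximal (Finsupp.support_nonempty_iff.mpr hne)
  have hs : coeffShift m e = Finsupp.single 0 (e m) := by
    classical
    ext g
    rw [coeffShift_apply, Finsupp.single_apply]
    split_ifs with hg
    · rw [← hg, zero_add]
    · by_contra hne'
      have h1 := hm.2 (Finsupp.mem_support_iff.mpr hne') le_add_self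
      exact hg (le_antisymm (zero_le) (by simpa using h1))
  have h0 := key m e h
  rw [hs] at h0
  obtain ⟨n, hn⟩ := h0.exists
  exact Finsupp.mem_support_iff.mp hm.1 (by simpa using hn.symm)

theorem unique (h : EventuallyBinomial f e) (h' : EventuallyBinomial f e') : e = e' := by
  rw [← sub_eq_zero]
  exact eq_zero ((h.sub h').congr (Eventually.of_forall fun n => by simp))

end EventuallyBinomial

/-- A function whose backward differences vanish for large arguments is eventually constant. -/
theorem eventually_const_of_backwardDiff {g : (Fin d → ℕ) → ℤ}
    (h : ∀ i, ∀ᶠ n in atTop, backwardDiff i g n = 0) : ∃ c, ∀ᶠ n in atTop, g n = c := by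
  obtain ⟨n₀, hn₀⟩ := eventually_ge_vector (eventually_all.2 h)
  have key : ∀ v, ∀ n, n₀ ≤ n → g (n + v) = g n := by
    intro v
    induction v using vector_induction with
    | h0 => simp
    | hadd v w hv hw =>
      intro n hn
      rw [← add_assoc, hw _ (hn.trans le_self_add), hv n hn]
    | hs i =>
      intro n hn
      have := hn₀ (n + Pi.single i 1) (hn.trans le_self_add) i
      rwa [backwardDiff, add_tsub_cancel_right, sub_eq_zero] at this
  refine ⟨g n₀, (eventually_ge_atTop n₀).mono fun n hn => ?_⟩
  obtain ⟨v, rfl⟩ := exists_add_of_le hn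
  exact key v n₀ le_rfl

/-- A function all of whose backward differences are eventually numerical polynomials is itself
eventually a numerical polynomial. The coefficients `e i` of the differences are compatible because
the difference operators commute, so `e (h + e_i) = e i h` defines the coefficients of `f` other
than the constant one. -/
theorem exists_eventuallyBinomial_of_backwardDiff {f : (Fin d → ℕ) → ℤ}
    (h : ∀ i, ∃ e, EventuallyBinomial (backwardDiff i f) e) : ∃ e, EventuallyBinomial f e := by
  classical
  choose e he using h
  have hcompat : ∀ i j, coeffShift (Pi.single j 1) (e i) = coeffShift (Pi.single i 1) (e j) := by
    intro i j
    refine ((he i).backwardDiff j).unique (((he j).backwardDiff i).congr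
      (Eventually.of_forall fun n => ?_))
    simp only [backwardDiff]
    rw [tsub_right_comm (a := n) (b := Pi.single j 1)]
    ring
  let φ : (Fin d → ℕ) → ℤ := fun g =>
    if hg : ∃ i, g i ≠ 0 then e hg.choose (g - Pi.single hg.choose 1) else 0
  have hφ : ∀ i g, φ (g + Pi.single i 1) = e i g := by
    intro i g
    have hg : ∃ j, (g + (Pi.single i 1 : Fin d → ℕ)) j ≠ 0 := ⟨i, by simp⟩
    have hφ' : φ (g + Pi.single i 1) =
      e hg.choose (g + Pi.single i 1 - Pi.single hg.choose 1) := dif_pos hg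
    have hspec := hg.choose_spec
    rw [hφ']
    generalize hg.choose = j at hspec ⊢
    by_cases hij : j = i
    · subst hij; rw [add_tsub_cancel_right]
    · obtain ⟨g', rfl⟩ := exists_eq_add_single (i := j) (g := g) (by simpa [hij] using hspec)
      rw [add_right_comm, add_tsub_cancel_right]
      exact DFunLike.congr_fun (hcompat j i) g'
  let s : Finset (Fin d → ℕ) :=
    Finset.univ.biUnion fun i => (e i).support.image (· + Pi.single i 1)
  let E : (Fin d → ℕ) →₀ ℤ := Finsupp.onFinset s φ (by
    intro g hg
    have hex : ∃ i, g i ≠ 0 := by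
      by_contra hne
      exact hg (dif_neg hne)
    obtain ⟨i, hi⟩ := hex
    obtain ⟨g', rfl⟩ := exists_eq_add_single hi
    rw [hφ] at hg
    simp only [s, Finset.mem_biUnion, Finset.mem_univ, true_and, Finset.mem_image]
    exact ⟨i, g', Finsupp.mem_support_iff.mpr hg, rfl⟩)
  have hE : ∀ i, coeffShift (Pi.single i 1) E = e i := fun i => by
    ext g; exact hφ i g
  have hEE : EventuallyBinomial (binomialSum E) E := Eventually.of_forall fun _ => rfl
  obtain ⟨c, hc⟩ := eventually_const_of_backwardDiff (g := fun n => f n - binomialSum E n)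
    (fun i => by
      have h1 := hEE.backwardDiff i
      rw [hE] at h1
      filter_upwards [he i, h1] with n h2 h3
      have h4 : backwardDiff i (fun n => f n - binomialSum E n) n =
        backwardDiff i f n - backwardDiff i (binomialSum E) n := by
        simp only [backwardDiff]; ring
      rw [h4, h2, h3, sub_self])
  refine ⟨E + Finsupp.single 0 c, hc.mono fun n hn => ?_⟩
  rw [binomialSum_add, binomialSum_single, binomialValue_zero, mul_one, ← hn]
  ring

end Binomial

/-! ### Homogeneous components and homogeneous submodules -/

section Graded

variable {d : ℕ} {A : Type u} {S : Type v} {M : Type w} [CommRing A] [CommRing S] [Algebra A S]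
  [AddCommGroup M] [Module A M] [Module S M]

/-- The `A`-linear projection of a graded module onto its component of degree `n`. -/
def homogProj (ℳ : (Fin d → ℕ) → Submodule A M) [DirectSum.Decomposition ℳ] (n : Fin d → ℕ) :
    M →ₗ[A] M :=
  (ℳ n).subtype ∘ₗ DirectSum.component A (Fin d → ℕ) (fun n => ℳ n) n ∘ₗ
    (DirectSum.decomposeLinearEquiv ℳ).toLinearMap

section Proj

variable (ℳ : (Fin d → ℕ) → Submodule A M) [DirectSum.Decomposition ℳ]

theorem homogProj_apply (n : Fin d → ℕ) (m : M) :
    homogProj ℳ n m = (DirectSum.decompose ℳ m n : M) := rfl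

theorem homogProj_mem (n : Fin d → ℕ) (m : M) : homogProj ℳ n m ∈ ℳ n :=
  (DirectSum.decompose ℳ m n).2

variable {ℳ} in
theorem homogProj_of_mem {n : Fin d → ℕ} {m : M} (hm : m ∈ ℳ n) : homogProj ℳ n m = m :=
  DirectSum.decompose_of_mem_same ℳ hm

variable {ℳ} in
theorem homogProj_of_mem_ne {n n' : Fin d → ℕ} {m : M} (hm : m ∈ ℳ n) (h : n ≠ n') :
    homogProj ℳ n' m = 0 :=
  DirectSum.decompose_of_mem_ne ℳ hm h

theorem mem_of_homogProj_mem {T : AddSubmonoid M} {m : M} (h : ∀ n, homogProj ℳ n m ∈ T) :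
    m ∈ T := by
  classical
  rw [← DirectSum.sum_support_decompose ℳ m]
  exact T.sum_mem fun n _ => h n

theorem iSup_eq_top_of_decomposition : iSup ℳ = ⊤ := by
  rw [eq_top_iff]
  intro m _
  exact mem_of_homogProj_mem ℳ (T := (iSup ℳ).toAddSubmonoid)
    fun n => Submodule.mem_iSup_of_mem n (homogProj_mem ℳ n m)

end Proj

/-- A family of submodules that spans and has a family of projections is a grading. -/
theorem nonempty_decomposition_of_proj {ι : Type*} [DecidableEq ι] (ℳ : ι → Submodule A M)
    (p : ι → M →ₗ[A] M) (same : ∀ n, ∀ m ∈ ℳ n, p n m = m)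
    (ne : ∀ n n', n ≠ n' → ∀ m ∈ ℳ n, p n' m = 0) (hsup : iSup ℳ = ⊤) :
    Nonempty (DirectSum.Decomposition ℳ) := by
  refine ⟨(DirectSum.isInternal_submodule_of_iSupIndep_of_iSup_eq_top ?_ hsup).chooseDecomposition⟩
  intro n
  rw [Submodule.disjoint_def]
  intro m hm hm'
  have hle : (⨆ j, ⨆ _ : j ≠ n, ℳ j) ≤ LinearMap.ker (p n) :=
    iSup₂_le fun j hj x hx => ne j n hj x hx
  rw [← same n m hm]
  exact hle hm'

theorem smul_mem_graded {𝒮 : (Fin d → ℕ) → Submodule A S} {ℳ : (Fin d → ℕ) → Submodule A M}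
    [SetLike.GradedSMul 𝒮 ℳ] {a n : Fin d → ℕ} {s : S} {m : M} (hs : s ∈ 𝒮 a) (hm : m ∈ ℳ n) :
    s • m ∈ ℳ (a + n) :=
  SetLike.GradedSMul.smul_mem hs hm

variable (𝒮 : (Fin d → ℕ) → Submodule A S) [GradedAlgebra 𝒮]
  (ℳ : (Fin d → ℕ) → Submodule A M) [DirectSum.Decomposition ℳ] [SetLike.GradedSMul 𝒮 ℳ]

omit [GradedAlgebra 𝒮] in
variable {𝒮} in
theorem homogProj_smul {a : Fin d → ℕ} {s : S} (hs : s ∈ 𝒮 a) (n : Fin d → ℕ) (m : M) :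
    homogProj ℳ (a + n) (s • m) = s • homogProj ℳ n m := by
  induction m using DirectSum.Decomposition.inductionOn ℳ with
  | zero => simp
  | @homogeneous i m =>
    by_cases h : i = n
    · subst h
      rw [homogProj_of_mem m.2, homogProj_of_mem (smul_mem_graded hs m.2)]
    · rw [homogProj_of_mem_ne m.2 h, homogProj_of_mem_ne (smul_mem_graded hs m.2)
        (fun h' => h (add_left_cancel h')), smul_zero]
  | add m m' hm hm' => rw [smul_add, map_add, hm, hm', map_add, smul_add]

omit [GradedAlgebra 𝒮] in
variable {𝒮} in
theorem homogProj_smul_of_not_le {a n : Fin d → ℕ} {s : S} (hs : s ∈ 𝒮 a) (h : ¬ a ≤ n) (m : M) :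
    homogProj ℳ n (s • m) = 0 := by
  induction m using DirectSum.Decomposition.inductionOn ℳ with
  | zero => simp
  | @homogeneous i m =>
    exact homogProj_of_mem_ne (smul_mem_graded hs m.2) fun h' => h (h' ▸ le_self_add)
  | add m m' hm hm' => rw [smul_add, map_add, hm, hm', add_zero]

variable {ℳ} in
theorem homogProj_smul_right {a : Fin d → ℕ} {m : M} (hm : m ∈ ℳ a) (n : Fin d → ℕ) (s : S) :
    homogProj ℳ (n + a) (s • m) = homogProj 𝒮 n s • m := by
  induction s using DirectSum.Decomposition.inductionOn 𝒮 with
  | zero => simp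
  | @homogeneous i s =>
    by_cases h : i = n
    · subst h
      rw [homogProj_of_mem s.2, homogProj_of_mem (smul_mem_graded s.2 hm)]
    · rw [homogProj_of_mem_ne s.2 h, homogProj_of_mem_ne (smul_mem_graded s.2 hm)
        (fun h' => h (add_right_cancel h')), zero_smul]
  | add s s' hs hs' => rw [add_smul, map_add, hs, hs', map_add, add_smul]

include 𝒮 in
variable {ℳ} in
theorem homogProj_smul_right_of_not_le {a n : Fin d → ℕ} {m : M} (hm : m ∈ ℳ a) (h : ¬ a ≤ n)
    (s : S) : homogProj ℳ n (s • m) = 0 := by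
  induction s using DirectSum.Decomposition.inductionOn 𝒮 with
  | zero => simp
  | @homogeneous i s =>
    exact homogProj_of_mem_ne (smul_mem_graded s.2 hm) fun h' => h (h' ▸ le_add_self)
  | add s s' hs hs' => rw [add_smul, map_add, hs, hs', add_zero]

/-- A homogeneous submodule: one that contains the homogeneous components of its elements. -/
def IsHomogSubmodule (N : Submodule S M) : Prop :=
  ∀ n, ∀ m ∈ N, homogProj ℳ n m ∈ N

theorem isHomogSubmodule_iff_isHomogeneous (I : Ideal S) :
    IsHomogSubmodule 𝒮 I ↔ I.IsHomogeneous 𝒮 :=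
  ⟨fun h n _ hx => h n _ hx, fun h n _ hx => h n hx⟩

omit [Algebra A S] in
theorem isHomogSubmodule_bot : IsHomogSubmodule ℳ (⊥ : Submodule S M) := by
  intro n m hm
  rw [Submodule.mem_bot] at hm ⊢
  rw [hm, map_zero]

omit [Algebra A S] in
variable {ℳ} in
theorem IsHomogSubmodule.sup {N N' : Submodule S M} (h : IsHomogSubmodule ℳ N)
    (h' : IsHomogSubmodule ℳ N') : IsHomogSubmodule ℳ (N ⊔ N') := by
  intro n m hm
  obtain ⟨y, hy, z, hz, rfl⟩ := Submodule.mem_sup.mp hm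
  rw [map_add]
  exact Submodule.add_mem_sup (h n y hy) (h' n z hz)

include 𝒮 in
variable {ℳ} in
theorem isHomogSubmodule_span_singleton {a : Fin d → ℕ} {m : M} (hm : m ∈ ℳ a) :
    IsHomogSubmodule ℳ (Submodule.span S {m}) := by
  intro n x hx
  obtain ⟨s, rfl⟩ := Submodule.mem_span_singleton.mp hx
  by_cases h : a ≤ n
  · obtain ⟨b, rfl⟩ := exists_add_of_le h
    rw [add_comm, homogProj_smul_right 𝒮 hm]
    exact Submodule.smul_mem _ _ (Submodule.mem_span_singleton_self m)
  · rw [homogProj_smul_right_of_not_le 𝒮 hm h]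
    exact zero_mem _

omit [GradedAlgebra 𝒮] in
variable {𝒮} in
theorem isHomogSubmodule_smul_top {a : Fin d → ℕ} {s : S} (hs : s ∈ 𝒮 a) :
    IsHomogSubmodule ℳ (Ideal.span {s} • (⊤ : Submodule S M)) := by
  intro n x hx
  rw [Submodule.ideal_span_singleton_smul] at hx ⊢
  obtain ⟨y, -, rfl⟩ := (Submodule.mem_smul_pointwise_iff_exists _ _ _).mp hx
  by_cases h : a ≤ n
  · obtain ⟨b, rfl⟩ := exists_add_of_le h
    rw [homogProj_smul ℳ hs]
    exact Submodule.smul_mem_pointwise_smul _ _ _ Submodule.mem_top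
  · rw [homogProj_smul_of_not_le ℳ hs h]
    exact zero_mem _

omit [GradedAlgebra 𝒮] in
variable {𝒮} in
theorem isHomogSubmodule_torsionBy {a : Fin d → ℕ} {s : S} (hs : s ∈ 𝒮 a) :
    IsHomogSubmodule ℳ (Submodule.torsionBy S M s) := by
  intro n x hx
  rw [Submodule.mem_torsionBy_iff] at hx ⊢
  rw [← homogProj_smul ℳ hs, hx, map_zero]

/-- The ideal `N : m` of all `s` with `s m ∈ N`. -/
def elementColon (N : Submodule S M) (m : M) : Ideal S :=
  N.comap (LinearMap.toSpanSingleton S M m)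

omit [Module A M] [Algebra A S] in
@[simp] theorem mem_elementColon {N : Submodule S M} {m : M} {s : S} :
    s ∈ elementColon N m ↔ s • m ∈ N := Iff.rfl

variable {ℳ} in
theorem isHomogeneous_elementColon {N : Submodule S M} (hN : IsHomogSubmodule ℳ N)
    {a : Fin d → ℕ} {m : M} (hm : m ∈ ℳ a) : (elementColon N m).IsHomogeneous 𝒮 := by
  intro n s hs
  rw [mem_elementColon] at hs ⊢
  rw [← homogProj_apply, ← homogProj_smul_right 𝒮 hm]
  exact hN _ _ hs

omit [Algebra A S] in
include ℳ in
variable {ℳ} in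
theorem exists_homog_notMem {N : Submodule S M} (hN : N ≠ ⊤) :
    ∃ a, ∃ m ∈ ℳ a, m ∉ N := by
  by_contra! h
  exact hN (eq_top_iff.mpr fun m _ => mem_of_homogProj_mem ℳ (T := N.toAddSubmonoid)
    fun n => h n _ (homogProj_mem ℳ n m))

omit [Algebra A S] in
variable (S) in
theorem span_components_eq_top : Submodule.span S (⋃ n, (ℳ n : Set M)) = ⊤ := by
  by_contra h
  obtain ⟨a, m, hm, hmN⟩ := exists_homog_notMem (ℳ := ℳ) h
  exact hmN (Submodule.subset_span (Set.mem_iUnion.mpr ⟨a, hm⟩))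

end Graded

/-! ### Primality of homogeneous ideals -/

section Prime

variable {d : ℕ} {A : Type u} {S : Type v} [CommRing A] [CommRing S] [Algebra A S]

/-- A proper homogeneous ideal that satisfies the primality condition for homogeneous elements is
prime, if the degrees can be ordered linearly: the grading is transported along `φ`, so that
Mathlib's result for linearly ordered degrees applies. -/
theorem isPrime_of_homogeneous_of_addEquiv {ι : Type*} [AddCommMonoid ι] [LinearOrder ι]
    [IsOrderedCancelAddMonoid ι] (φ : ι ≃+ (Fin d → ℕ))
    (𝒮 : (Fin d → ℕ) → Submodule A S) [GradedAlgebra 𝒮] {I : Ideal S}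
    (hI : I.IsHomogeneous 𝒮) (htop : I ≠ ⊤)
    (h : ∀ {a b : Fin d → ℕ} {x y : S}, x ∈ 𝒮 a → y ∈ 𝒮 b → x * y ∈ I → x ∈ I ∨ y ∈ I) :
    I.IsPrime := by
  let 𝒯 : ι → Submodule A S := fun n => 𝒮 (φ n)
  have hsup : iSup 𝒯 = ⊤ := by
    rw [← iSup_eq_top_of_decomposition 𝒮]
    exact φ.toEquiv.iSup_comp (g := 𝒮)
  obtain ⟨D⟩ := nonempty_decomposition_of_proj 𝒯 (fun n => homogProj 𝒮 (φ n))
    (fun n m hm => homogProj_of_mem hm)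
    (fun n n' hn m hm => homogProj_of_mem_ne hm fun h' => hn (φ.injective h')) hsup
  have : SetLike.GradedMonoid 𝒯 :=
    { one_mem := by
        change (1 : S) ∈ 𝒮 (φ 0)
        rw [map_zero]
        exact SetLike.GradedOne.one_mem
      mul_mem := fun a b x y hx hy => by
        change x * y ∈ 𝒮 (φ (a + b))
        rw [map_add]
        exact SetLike.GradedMul.mul_mem hx hy }
  let _ : GradedRing 𝒯 := { this, D with }
  have hD : ∀ x n, (DirectSum.decompose 𝒯 x n : S) = homogProj 𝒮 (φ n) x := by
    intro x n
    induction x using DirectSum.Decomposition.inductionOn 𝒯 with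
    | zero => simp
    | @homogeneous i x =>
      by_cases hi : i = n
      · subst hi
        rw [DirectSum.decompose_of_mem_same 𝒯 x.2]
        exact (homogProj_of_mem (ℳ := 𝒮) x.2).symm
      · rw [DirectSum.decompose_of_mem_ne 𝒯 x.2 hi]
        exact (homogProj_of_mem_ne (ℳ := 𝒮) x.2 fun h' => hi (φ.injective h')).symm
    | add x y hx hy => rw [DirectSum.decompose_add, DirectSum.add_apply, Submodule.coe_add, hx, hy,
        map_add]
  have hI' : I.IsHomogeneous 𝒯 := fun n x hx => by
    rw [hD]
    exact hI _ hx
  refine Ideal.IsHomogeneous.isPrime_of_homogeneous_mem_or_mem hI' htop ?_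
  rintro x y ⟨a, ha⟩ ⟨b, hb⟩ hxy
  exact h ha hb hxy

/-- A proper homogeneous ideal is prime if it satisfies the primality condition for homogeneous
elements; the lexicographic order is a suitable linear order on `ℕ^d`. -/
theorem isPrime_of_homogeneous (𝒮 : (Fin d → ℕ) → Submodule A S) [GradedAlgebra 𝒮] {I : Ideal S}
    (hI : I.IsHomogeneous 𝒮) (htop : I ≠ ⊤)
    (h : ∀ {a b : Fin d → ℕ} {x y : S}, x ∈ 𝒮 a → y ∈ 𝒮 b → x * y ∈ I → x ∈ I ∨ y ∈ I) :
    I.IsPrime :=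
  isPrime_of_homogeneous_of_addEquiv (ι := Lex (Fin d → ℕ))
    { ofLex with map_add' := fun _ _ => rfl } 𝒮 hI htop h

end Prime

/-! ### Graded pieces of standard graded algebras and their modules are finitely generated -/

section Finite

variable {d : ℕ} {A : Type u} {S : Type v} {M : Type w} [CommRing A] [CommRing S] [Algebra A S]
  [AddCommGroup M] [Module A M] [Module S M] [IsScalarTower A S M]
  (𝒮 : (Fin d → ℕ) → Submodule A S) [GradedAlgebra 𝒮]
  (ℳ : (Fin d → ℕ) → Submodule A M) [DirectSum.Decomposition ℳ] [SetLike.GradedSMul 𝒮 ℳ]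

variable {𝒮} in
/-- In a standard graded algebra the component of degree `n` is spanned by monomials in the elements
of total degree one. -/
theorem IsStandardGraded.mem_span_monomials (hS : IsStandardGraded 𝒮) {n : Fin d → ℕ} {s : S}
    (hs : s ∈ 𝒮 n) :
    s ∈ Submodule.span A {t : S | t ∈ 𝒮 n ∧ (n = 0 → t = 1) ∧
      ∀ i, n i ≠ 0 → t ∈ Ideal.span (𝒮 (Pi.single i 1) : Set S)} := by
  set T : Submodule A S := Submodule.span A {t : S | t ∈ 𝒮 n ∧ (n = 0 → t = 1) ∧
      ∀ i, n i ≠ 0 → t ∈ Ideal.span (𝒮 (Pi.single i 1) : Set S)} with hT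
  have hmono : ∀ t ∈ Submonoid.closure (⋃ i : Fin d, (𝒮 (Pi.single i 1) : Set S)),
      ∃ m, t ∈ 𝒮 m ∧ (m = 0 → t = 1) ∧
        ∀ i, m i ≠ 0 → t ∈ Ideal.span (𝒮 (Pi.single i 1) : Set S) := by
    intro t ht
    induction ht using Submonoid.closure_induction with
    | mem t ht =>
      obtain ⟨i, hi⟩ := Set.mem_iUnion.mp ht
      refine ⟨Pi.single i 1, hi, fun h => ?_, fun j hj => ?_⟩
      · simpa using congrFun h i
      · have : j = i := by
          by_contra hne
          simp [hne] at hj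
        subst this
        exact Ideal.subset_span hi
    | one => exact ⟨0, SetLike.GradedOne.one_mem, fun _ => rfl, fun i hi => absurd rfl hi⟩
    | mul t t' _ _ ht ht' =>
      obtain ⟨m, h1, h2, h3⟩ := ht
      obtain ⟨m', h1', h2', h3'⟩ := ht'
      refine ⟨m + m', SetLike.GradedMul.mul_mem h1 h1', fun h => ?_, fun i hi => ?_⟩
      · rw [add_eq_zero] at h
        rw [h2 h.1, h2' h.2, one_mul]
      · by_cases hm : m i = 0
        · exact Ideal.mul_mem_left _ _ (h3' i (by simpa [hm] using hi))
        · exact Ideal.mul_mem_right _ _ (h3 i hm)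
  have key : ∀ t, homogProj 𝒮 n t ∈ T := by
    intro t
    have ht : t ∈ Submodule.span A
        (Submonoid.closure (⋃ i : Fin d, (𝒮 (Pi.single i 1) : Set S)) : Set S) := by
      rw [← Algebra.adjoin_eq_span, hS.2]
      trivial
    induction ht using Submodule.span_induction with
    | mem t ht =>
      obtain ⟨m, h1, h2, h3⟩ := hmono t ht
      by_cases hmn : m = n
      · subst hmn
        rw [homogProj_of_mem h1]
        exact Submodule.subset_span ⟨h1, h2, h3⟩
      · rw [homogProj_of_mem_ne h1 hmn]
        exact zero_mem _
    | zero => rw [map_zero]; exact zero_mem _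
    | add x y _ _ hx hy => rw [map_add]; exact add_mem hx hy
    | smul a x _ hx => rw [map_smul]; exact T.smul_mem a hx
  rw [← homogProj_of_mem hs]
  exact key s

variable {𝒮} in
theorem IsStandardGraded.zero_le_one (hS : IsStandardGraded 𝒮) :
    𝒮 0 ≤ Submodule.span A {(1 : S)} := fun _ hs =>
  Submodule.span_mono (fun _ ht => ht.2.1 rfl) (hS.mem_span_monomials hs)

variable {𝒮} in
/-- A component whose degree has a positive `i`-th entry lies in the ideal generated by `S_i`. -/
theorem IsStandardGraded.le_span (hS : IsStandardGraded 𝒮) {n : Fin d → ℕ} {i : Fin d}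
    (hi : n i ≠ 0) {s : S} (hs : s ∈ 𝒮 n) : s ∈ Ideal.span (𝒮 (Pi.single i 1) : Set S) := by
  have hle : Submodule.span A {t : S | t ∈ 𝒮 n ∧ (n = 0 → t = 1) ∧
      ∀ i, n i ≠ 0 → t ∈ Ideal.span (𝒮 (Pi.single i 1) : Set S)} ≤
      (Ideal.span (𝒮 (Pi.single i 1) : Set S)).restrictScalars A :=
    Submodule.span_le.mpr fun t ht => ht.2.2 i hi
  exact hle (hS.mem_span_monomials hs)

omit [GradedAlgebra 𝒮] in
variable {𝒮} in
theorem IsStandardGraded.isNoetherianRing [IsNoetherianRing A] (hS : IsStandardGraded 𝒮) :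
    IsNoetherianRing S :=
  have := hS.1
  Algebra.FiniteType.isNoetherianRing A S

variable {ℳ} in
/-- If finitely many homogeneous elements generate a submodule that contains the component of degree
`n`, then this component is finitely generated as soon as the relevant components of the algebra
are. -/
theorem fg_of_le_span {ι : Type*} [Finite ι] (g : ι → M) (a : ι → Fin d → ℕ)
    (hg : ∀ j, g j ∈ ℳ (a j)) {n : Fin d → ℕ} (hfg : ∀ j, a j ≤ n → (𝒮 (n - a j)).FG)
    (hn : ∀ m ∈ ℳ n, m ∈ Submodule.span S (Set.range g)) : (ℳ n).FG := by
  classical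
  have := Fintype.ofFinite ι
  let φ : ι → S →ₗ[A] M := fun j => (LinearMap.toSpanSingleton S M (g j)).restrictScalars A
  let W : ι → Submodule A M := fun j => if a j ≤ n then (𝒮 (n - a j)).map (φ j) else ⊥
  have hW : (⨆ j, W j).FG := by
    refine Submodule.fg_iSup _ fun j => ?_
    by_cases h : a j ≤ n
    · simp only [W, if_pos h]
      exact (hfg j h).map _
    · simp only [W, if_neg h]
      exact Submodule.fg_bot
  convert hW
  refine le_antisymm (fun m hm => ?_) (iSup_le fun j => ?_)
  · obtain ⟨c, hc⟩ := (Submodule.mem_span_range_iff_exists_fun S).mp (hn m hm)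
    rw [← homogProj_of_mem hm, ← hc, map_sum]
    refine sum_mem fun j _ => Submodule.mem_iSup_of_mem j ?_
    by_cases h : a j ≤ n
    · simp only [W, if_pos h]
      refine ⟨homogProj 𝒮 (n - a j) (c j), homogProj_mem _ _ _, ?_⟩
      have := homogProj_smul_right 𝒮 (hg j) (n - a j) (c j)
      rw [tsub_add_cancel_of_le h] at this
      exact this.symm
    · rw [homogProj_smul_right_of_not_le 𝒮 (hg j) h]
      exact zero_mem _
  · by_cases h : a j ≤ n
    · simp only [W, if_pos h]
      rintro _ ⟨s, hs, rfl⟩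
      have := smul_mem_graded (ℳ := ℳ) hs (hg j)
      rwa [tsub_add_cancel_of_le h] at this
    · simp [W, if_neg h]

variable {𝒮} in
theorem IsStandardGraded.fg_component [IsNoetherianRing A] (hS : IsStandardGraded 𝒮)
    (n : Fin d → ℕ) : (𝒮 n).FG := by
  have := hS.isNoetherianRing
  induction hN : ∑ i, n i generalizing n with
  | zero =>
    have h0 : n = 0 := by
      ext i
      exact (Finset.sum_eq_zero_iff.mp hN) i (Finset.mem_univ i)
    subst h0
    exact (Submodule.fg_span_singleton (1 : S)).of_le hS.zero_le_one
  | succ N ih =>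
    -- `S_n` lies in the ideal generated by finitely many elements of `S_i`, with coefficients in
    -- `S_{n - e_i}`.
    obtain ⟨i, -, hi⟩ : ∃ i ∈ Finset.univ, n i ≠ 0 := by
      by_contra! h
      rw [Finset.sum_eq_zero h] at hN
      omega
    obtain ⟨t, ht, htJ⟩ := Submodule.fg_span_iff_fg_span_finset_subset _ |>.mp
      (IsNoetherian.noetherian (Ideal.span (𝒮 (Pi.single i 1) : Set S)))
    refine fg_of_le_span 𝒮 (fun j : t => (j : S)) (fun _ => Pi.single i 1) (fun j => ht j.2)
      (fun _ _ => ih _ ?_) fun m hm => ?_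
    · obtain ⟨n', rfl⟩ := exists_eq_add_single hi
      rw [add_tsub_cancel_right]
      simpa [Finset.sum_add_distrib, Finset.sum_pi_single] using hN
    · have := hS.le_span hi hm
      rw [show Set.range (fun j : t => (j : S)) = (t : Set S) by simp]
      rw [← Ideal.submodule_span_eq, htJ] at this
      exact this

variable {𝒮} in
/-- The components of a finitely generated graded module are finitely generated over `A`. -/
theorem IsStandardGraded.finite_component [IsNoetherianRing A] (hS : IsStandardGraded 𝒮)
    [Module.Finite S M] (n : Fin d → ℕ) : Module.Finite A (ℳ n) := by
  rw [Module.Finite.iff_fg]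
  have htop := span_components_eq_top S ℳ
  obtain ⟨t, ht, htJ⟩ := Submodule.fg_span_iff_fg_span_finset_subset (⋃ n, (ℳ n : Set M)) |>.mp
    (by rw [htop]; exact Module.Finite.fg_top)
  have hdeg : ∀ j : t, ∃ a, (j : M) ∈ ℳ a := fun j => Set.mem_iUnion.mp (ht j.2)
  choose a ha using hdeg
  refine fg_of_le_span 𝒮 (fun j : t => (j : M)) a ha (fun j _ => hS.fg_component _) fun m _ => ?_
  rw [show Set.range (fun j : t => (j : M)) = (t : Set M) by simp, ← htJ, htop]
  trivial

end Finite

/-! ### Hilbert functions -/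

section Length

variable {d : ℕ} {A : Type u} {S : Type v} {M : Type w} [CommRing A] [CommRing S] [Algebra A S]
  [AddCommGroup M] [Module A M]

theorem length_eq_inf_ker_add_map {M' : Type*} [AddCommGroup M'] [Module A M'] (f : M →ₗ[A] M')
    (V : Submodule A M) :
    Module.length A V = Module.length A ↥(V ⊓ LinearMap.ker f) + Module.length A (V.map f) := by
  refine Module.length_eq_add_of_exact (Submodule.inclusion inf_le_left) (f.submoduleMap V)
    (Submodule.inclusion_injective _) (f.submoduleMap_surjective V) ?_
  intro x
  constructor
  · intro hx
    have : f x = 0 := congrArg Subtype.val hx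
    exact ⟨⟨x, x.2, this⟩, rfl⟩
  · rintro ⟨y, rfl⟩
    exact Subtype.ext y.2.2

theorem length_map_congr {M' M'' : Type*} [AddCommGroup M'] [Module A M'] [AddCommGroup M'']
    [Module A M''] (f : M →ₗ[A] M') (g : M →ₗ[A] M'') (V : Submodule A M)
    (h : ∀ x ∈ V, f x = 0 ↔ g x = 0) :
    Module.length A (V.map f) = Module.length A (V.map g) := by
  have hker : LinearMap.ker (f ∘ₗ V.subtype) = LinearMap.ker (g ∘ₗ V.subtype) := by
    ext x
    exact h x x.2
  have aux : ∀ {M' : Type _} [AddCommGroup M'] [Module A M'] (f : M →ₗ[A] M'),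
      Module.length A (V.map f) = Module.length A (V ⧸ LinearMap.ker (f ∘ₗ V.subtype)) := by
    intro M' _ _ f
    rw [(LinearMap.quotKerEquivRange (f ∘ₗ V.subtype)).length_eq, LinearMap.range_comp,
      Submodule.range_subtype]
  rw [aux f, hker]
  rw [(LinearMap.quotKerEquivRange (g ∘ₗ V.subtype)).length_eq, LinearMap.range_comp,
      Submodule.range_subtype]

theorem length_map_injective {M' : Type*} [AddCommGroup M'] [Module A M'] (f : M →ₗ[A] M')
    (hf : Function.Injective f) (V : Submodule A M) :
    Module.length A (V.map f) = Module.length A V :=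
  (Submodule.equivMapOfInjective f hf V).length_eq.symm

variable (A) in
/-- The Hilbert function `n ↦ ℓ_A(M_n)`, with the value `0` in degrees of infinite length. -/
def hilbertFun (ℳ : (Fin d → ℕ) → Submodule A M) (n : Fin d → ℕ) : ℤ :=
  ((Module.length A (ℳ n)).toNat : ℤ)

variable [Module S M] [IsScalarTower A S M]

/-- The family of the images of the components of `M` in `M / N`. -/
def quotientGrading (ℳ : (Fin d → ℕ) → Submodule A M) (N : Submodule S M) (n : Fin d → ℕ) :
    Submodule A (M ⧸ N) :=
  (ℳ n).map (N.mkQ.restrictScalars A)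

theorem hilbertFun_quotientGrading_bot (ℳ : (Fin d → ℕ) → Submodule A M) :
    hilbertFun A (quotientGrading ℳ (⊥ : Submodule S M)) = hilbertFun A ℳ := by
  ext n
  rw [hilbertFun, hilbertFun, quotientGrading, length_map_injective]
  intro x y hxy
  have : Submodule.Quotient.mk (p := (⊥ : Submodule S M)) x = Submodule.Quotient.mk y := hxy
  rw [Submodule.Quotient.eq, Submodule.mem_bot, sub_eq_zero] at this
  exact this

theorem hilbertFun_quotientGrading_eq_zero (ℳ : (Fin d → ℕ) → Submodule A M) {N : Submodule S M}
    {n : Fin d → ℕ} (h : ∀ m ∈ ℳ n, m ∈ N) : hilbertFun A (quotientGrading ℳ N) n = 0 := by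
  have : quotientGrading ℳ N n = ⊥ := by
    rw [eq_bot_iff]
    rintro _ ⟨m, hm, rfl⟩
    exact (Submodule.Quotient.mk_eq_zero _).mpr (h m hm)
  rw [hilbertFun, this, Module.length_bot]
  rfl

theorem length_quotientGrading_ne_top {ℳ : (Fin d → ℕ) → Submodule A M}
    (hfin : ∀ n, Module.length A (ℳ n) ≠ ⊤) (N : Submodule S M) (n : Fin d → ℕ) :
    Module.length A (quotientGrading ℳ N n) ≠ ⊤ := by
  have h := length_eq_inf_ker_add_map (N.mkQ.restrictScalars A) (ℳ n)
  intro htop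
  apply hfin n
  rw [h]
  change _ + Module.length A (quotientGrading ℳ N n) = ⊤
  rw [htop, add_top]

variable (𝒮 : (Fin d → ℕ) → Submodule A S) [GradedAlgebra 𝒮]
  {ℳ : (Fin d → ℕ) → Submodule A M} [DirectSum.Decomposition ℳ] [SetLike.GradedSMul 𝒮 ℳ]

/-- Lengths in the exact sequence `0 → (S / (N : m))(-a) → M / N → M / (N + S m) → 0` for a
homogeneous element `m` of degree `a`. -/
theorem length_quotientGrading_add {N : Submodule S M} (hN : IsHomogSubmodule ℳ N)
    {a : Fin d → ℕ} {m : M} (hm : m ∈ ℳ a) (n : Fin d → ℕ) :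
    Module.length A (quotientGrading ℳ N (n + a)) =
      Module.length A (quotientGrading 𝒮 (elementColon N m) n) +
        Module.length A (quotientGrading ℳ (N ⊔ Submodule.span S {m}) (n + a)) := by
  set N' := N ⊔ Submodule.span S {m} with hN'
  let q : (M ⧸ N) →ₗ[A] (M ⧸ N') := (Submodule.factor (le_sup_left : N ≤ N')).restrictScalars A
  rw [length_eq_inf_ker_add_map q (quotientGrading ℳ N (n + a))]
  congr 1
  · let φ : S →ₗ[A] (M ⧸ N) := (N.mkQ ∘ₗ LinearMap.toSpanSingleton S M m).restrictScalars A
    have h1 : quotientGrading ℳ N (n + a) ⊓ LinearMap.ker q = (𝒮 n).map φ := by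
      ext y
      constructor
      · rintro ⟨⟨x, hx, rfl⟩, hy⟩
        have hy' : x ∈ N' := (Submodule.Quotient.mk_eq_zero _).mp hy
        obtain ⟨ν, hν, z, hz, hxz⟩ := Submodule.mem_sup.mp hy'
        obtain ⟨s, rfl⟩ := Submodule.mem_span_singleton.mp hz
        refine ⟨homogProj 𝒮 n s, homogProj_mem _ _ _, ?_⟩
        have hx' : x = homogProj ℳ (n + a) ν + homogProj 𝒮 n s • m := by
          rw [← homogProj_smul_right 𝒮 hm, ← map_add, hxz, homogProj_of_mem hx]
        refine ((Submodule.Quotient.eq N).mpr ?_).symm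
        have : x - homogProj 𝒮 n s • m = homogProj ℳ (n + a) ν := by
          nth_rewrite 1 [hx']
          abel
        change x - homogProj 𝒮 n s • m ∈ N
        rw [this]
        exact hN _ _ hν
      · rintro ⟨s, hs, rfl⟩
        refine ⟨⟨s • m, smul_mem_graded hs hm, rfl⟩, ?_⟩
        exact (Submodule.Quotient.mk_eq_zero N').mpr (Submodule.mem_sup_right
          (Submodule.smul_mem _ _ (Submodule.mem_span_singleton_self m)))
    rw [h1]
    refine length_map_congr _ _ _ fun s _ => ?_
    exact (Submodule.Quotient.mk_eq_zero N).trans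
      (Submodule.Quotient.mk_eq_zero (elementColon N m)).symm
  · rw [quotientGrading, quotientGrading, ← Submodule.map_comp]
    rfl

theorem hilbertFun_quotientGrading_add (hfin : ∀ n, Module.length A (𝒮 n) ≠ ⊤)
    (hfin' : ∀ n, Module.length A (ℳ n) ≠ ⊤) {N : Submodule S M} (hN : IsHomogSubmodule ℳ N)
    {a : Fin d → ℕ} {m : M} (hm : m ∈ ℳ a) {n : Fin d → ℕ} (hn : a ≤ n) :
    hilbertFun A (quotientGrading ℳ N) n =
      hilbertFun A (quotientGrading ℳ (N ⊔ Submodule.span S {m})) n +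
      hilbertFun A (quotientGrading 𝒮 (elementColon N m)) (n - a) := by
  have h := length_quotientGrading_add 𝒮 hN hm (n - a)
  rw [tsub_add_cancel_of_le hn] at h
  rw [hilbertFun, hilbertFun, hilbertFun, h, ENat.toNat_add
    (length_quotientGrading_ne_top hfin _ _) (length_quotientGrading_ne_top hfin' _ _)]
  push_cast
  ring

/-- Dévissage for cyclic graded modules: a property of functions that is inherited along the exact
sequences `0 → (S / (I : x))(-a) → S / I → S / (I + x S) → 0` holds for the Hilbert functions of
all `S / I`, if it holds for prime `I` under the assumption that it holds for all larger ideals. -/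
theorem devissage_ideal [IsNoetherianRing S] (hfin : ∀ n, Module.length A (𝒮 n) ≠ ⊤)
    {C : ((Fin d → ℕ) → ℤ) → Prop} (zero : C 0)
    (ext : ∀ (F G H : (Fin d → ℕ) → ℤ) (a : Fin d → ℕ), C G → C H →
      (∀ n, a ≤ n → F n = G n + H (n - a)) → C F) (I₀ : Ideal S)
    (prime : ∀ P : Ideal S, P.IsPrime → P.IsHomogeneous 𝒮 → I₀ ≤ P →
      (∀ J : Ideal S, J.IsHomogeneous 𝒮 → P < J → C (hilbertFun A (quotientGrading 𝒮 J))) →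
      C (hilbertFun A (quotientGrading 𝒮 P)))
    (I : Ideal S) (hI : I.IsHomogeneous 𝒮) (hI₀ : I₀ ≤ I) :
    C (hilbertFun A (quotientGrading 𝒮 I)) := by
  induction I using IsNoetherian.induction with
  | hgt I ih =>
  by_cases htop : I = ⊤
  · have : hilbertFun A (quotientGrading 𝒮 I) = 0 := by
      ext n
      exact hilbertFun_quotientGrading_eq_zero 𝒮 fun m _ => by simp [htop]
    rwa [this]
  by_cases hP : Ideal.IsPrime I
  · exact prime I hP hI hI₀ fun J hJ hlt => ih J hlt hJ (hI₀.trans hlt.le)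
  -- If `I` is not prime, both `I : x` and `I + x S` are strictly larger than `I`.
  have hex : ∃ (a b : Fin d → ℕ) (x y : S), x ∈ 𝒮 a ∧ y ∈ 𝒮 b ∧ x * y ∈ I ∧ x ∉ I ∧ y ∉ I := by
    by_contra! hne
    refine hP (isPrime_of_homogeneous 𝒮 hI htop fun {a b x y} hx hy hxy => ?_)
    by_contra! h
    exact h.2 (hne a b x y hx hy hxy h.1)
  obtain ⟨a, b, x, y, hx, hy, hxy, hxI, hyI⟩ := hex
  have hI' : IsHomogSubmodule 𝒮 I := (isHomogSubmodule_iff_isHomogeneous 𝒮 I).mpr hI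
  have hle : I ≤ elementColon I x := fun s hs => Ideal.mul_mem_right x I hs
  have hlt : I < elementColon I x := lt_of_le_of_ne hle fun h =>
    hyI (h ▸ (by rw [mem_elementColon, smul_eq_mul, mul_comm]; exact hxy))
  have hlt' : I < I ⊔ Submodule.span S {x} := lt_of_le_of_ne le_sup_left fun h =>
    hxI (h ▸ Submodule.mem_sup_right (Submodule.mem_span_singleton_self x))
  refine ext _ _ _ a (ih _ hlt' ?_ (hI₀.trans hlt'.le))
    (ih _ hlt (isHomogeneous_elementColon 𝒮 hI' hx) (hI₀.trans hle))
    fun n hn => hilbertFun_quotientGrading_add 𝒮 hfin hfin hI' hx hn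
  exact (isHomogSubmodule_iff_isHomogeneous 𝒮 _).mp
    (hI'.sup (isHomogSubmodule_span_singleton 𝒮 hx))

/-- Dévissage for finitely generated graded modules. -/
theorem devissage [IsNoetherianRing S] [Module.Finite S M]
    (hfin : ∀ n, Module.length A (𝒮 n) ≠ ⊤) (hfin' : ∀ n, Module.length A (ℳ n) ≠ ⊤)
    {C : ((Fin d → ℕ) → ℤ) → Prop} (zero : C 0)
    (ext : ∀ (F G H : (Fin d → ℕ) → ℤ) (a : Fin d → ℕ), C G → C H →
      (∀ n, a ≤ n → F n = G n + H (n - a)) → C F)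
    (prime : ∀ P : Ideal S, P.IsPrime → P.IsHomogeneous 𝒮 → Module.annihilator S M ≤ P →
      (∀ J : Ideal S, J.IsHomogeneous 𝒮 → P < J → C (hilbertFun A (quotientGrading 𝒮 J))) →
      C (hilbertFun A (quotientGrading 𝒮 P))) :
    C (hilbertFun A ℳ) := by
  have : IsNoetherian S M := isNoetherian_of_isNoetherianRing_of_finite S M
  have key : ∀ N : Submodule S M, IsHomogSubmodule ℳ N →
      C (hilbertFun A (quotientGrading ℳ N)) := by
    intro N
    induction N using IsNoetherian.induction with
    | hgt N ih =>
    intro hN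
    by_cases htop : N = ⊤
    · have : hilbertFun A (quotientGrading ℳ N) = 0 := by
        ext n
        exact hilbertFun_quotientGrading_eq_zero ℳ fun m _ => by simp [htop]
      rwa [this]
    obtain ⟨a, m, hm, hmN⟩ := exists_homog_notMem (ℳ := ℳ) htop
    have hlt : N < N ⊔ Submodule.span S {m} := lt_of_le_of_ne le_sup_left fun h =>
      hmN (h ▸ Submodule.mem_sup_right (Submodule.mem_span_singleton_self m))
    refine ext _ _ _ a (ih _ hlt (hN.sup (isHomogSubmodule_span_singleton 𝒮 hm)))
      (devissage_ideal 𝒮 hfin zero ext (Module.annihilator S M) prime _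
        (isHomogeneous_elementColon 𝒮 hN hm) fun s hs => ?_)
      fun n hn => hilbertFun_quotientGrading_add 𝒮 hfin hfin' hN hm hn
    rw [mem_elementColon, Module.mem_annihilator.mp hs]
    exact zero_mem _
  rw [← hilbertFun_quotientGrading_bot (S := S)]
  exact key ⊥ (isHomogSubmodule_bot ℳ)

end Length

/-! ### The Hilbert polynomial and the dimension of the relevant support -/

section Relevant

variable {d : ℕ} {A : Type u} {S : Type v} {M : Type w} [CommRing A] [CommRing S] [Algebra A S]
  [AddCommGroup M] [Module A M] [Module S M] [IsScalarTower A S M]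
  {𝒮 : (Fin d → ℕ) → Submodule A S} [GradedAlgebra 𝒮]

theorem IsStandardGraded.relevantIdeal_le (hS : IsStandardGraded 𝒮) {I : Ideal S} {i : Fin d}
    (hI : ∀ s ∈ 𝒮 (Pi.single i 1), s ∈ I) : relevantIdeal 𝒮 ≤ I := by
  refine Ideal.span_le.mpr fun s hs => ?_
  simp only [Set.mem_iUnion] at hs
  obtain ⟨n, hn, hs⟩ := hs
  have hni : n i ≠ 0 := Nat.one_le_iff_ne_zero.mp (hn i)
  exact (Ideal.span_le.mpr hI) (hS.le_span hni hs)

theorem IsStandardGraded.exists_notMem (hS : IsStandardGraded 𝒮) {P : Ideal S}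
    (hP : ¬ relevantIdeal 𝒮 ≤ P) (i : Fin d) : ∃ s ∈ 𝒮 (Pi.single i 1), s ∉ P := by
  by_contra! h
  exact hP (hS.relevantIdeal_le h)

theorem exists_component_notMem_of_single {P : Ideal S} [hPp : P.IsPrime]
    (hP : ∀ i, ∃ s ∈ 𝒮 (Pi.single i 1), s ∉ P) (n : Fin d → ℕ) : ∃ s ∈ 𝒮 n, s ∉ P := by
  induction n using vector_induction with
  | h0 => exact ⟨1, SetLike.GradedOne.one_mem, P.one_notMem⟩
  | hadd v w hv hw =>
    obtain ⟨s, hs, hsP⟩ := hv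
    obtain ⟨t, ht, htP⟩ := hw
    exact ⟨s * t, SetLike.GradedMul.mul_mem hs ht, fun h => (hPp.mem_or_mem h).elim hsP htP⟩
  | hs i => exact hP i

/-- A prime that does not contain `S_{++}` contains no component of `S`. -/
theorem IsStandardGraded.exists_component_notMem (hS : IsStandardGraded 𝒮) {P : Ideal S}
    [P.IsPrime] (hP : ¬ relevantIdeal 𝒮 ≤ P) (n : Fin d → ℕ) : ∃ s ∈ 𝒮 n, s ∉ P :=
  exists_component_notMem_of_single (hS.exists_notMem hP) n

theorem exists_single_subset_of_relevantIdeal_le {P : Ideal S} [P.IsPrime]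
    (hP : relevantIdeal 𝒮 ≤ P) : ∃ i, ∀ s ∈ 𝒮 (Pi.single i 1), s ∈ P := by
  by_contra! hne
  obtain ⟨s, hs, hsP⟩ := exists_component_notMem_of_single hne 1
  exact hsP (hP (Ideal.subset_span (Set.mem_iUnion₂.mpr ⟨1, le_rfl, hs⟩)))

theorem IsStandardGraded.eventually_hilbertFun_eq_zero (hS : IsStandardGraded 𝒮) {I : Ideal S}
    {i : Fin d} (hI : ∀ s ∈ 𝒮 (Pi.single i 1), s ∈ I) :
    ∀ᶠ n in atTop, hilbertFun A (quotientGrading 𝒮 I) n = 0 := by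
  filter_upwards [eventually_one_le i] with n hn
  refine hilbertFun_quotientGrading_eq_zero 𝒮 fun s hs => ?_
  exact (Ideal.span_le.mpr hI) (hS.le_span (Nat.one_le_iff_ne_zero.mp hn) hs)

theorem elementColon_eq_self {P : Ideal S} [hP : P.IsPrime] {x : S} (hx : x ∉ P) :
    elementColon P x = P := by
  ext s
  rw [mem_elementColon]
  exact ⟨fun h => (hP.mem_or_mem h).resolve_right hx, fun h => P.mul_mem_right x h⟩

theorem hilbertFun_prime_add (hfin : ∀ n, Module.length A (𝒮 n) ≠ ⊤) {P : Ideal S} [P.IsPrime]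
    (hPh : P.IsHomogeneous 𝒮) {a : Fin d → ℕ} {x : S} (hx : x ∈ 𝒮 a) (hxP : x ∉ P)
    {n : Fin d → ℕ} (hn : a ≤ n) :
    hilbertFun A (quotientGrading 𝒮 P) n =
      hilbertFun A (quotientGrading 𝒮 (P ⊔ Ideal.span {x})) n +
        hilbertFun A (quotientGrading 𝒮 P) (n - a) := by
  have h := hilbertFun_quotientGrading_add 𝒮 hfin hfin
    ((isHomogSubmodule_iff_isHomogeneous 𝒮 P).mpr hPh) hx hn
  rwa [elementColon_eq_self hxP] at h

/-- An element `x ∈ S_i \ P` is a nonzerodivisor on `S / P`, so the Hilbert function of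
`S / (P + x S)` is the backward difference of that of `S / P`. -/
theorem eventually_backwardDiff_prime (hfin : ∀ n, Module.length A (𝒮 n) ≠ ⊤) {P : Ideal S}
    [P.IsPrime] (hPh : P.IsHomogeneous 𝒮) {i : Fin d} {x : S} (hx : x ∈ 𝒮 (Pi.single i 1))
    (hxP : x ∉ P) :
    ∀ᶠ n in atTop, backwardDiff i (hilbertFun A (quotientGrading 𝒮 P)) n =
      hilbertFun A (quotientGrading 𝒮 (P ⊔ Ideal.span {x})) n := by
  filter_upwards [eventually_ge_atTop (Pi.single i 1)] with n hn
  rw [backwardDiff, hilbertFun_prime_add hfin hPh hx hxP hn, add_sub_cancel_right]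

theorem isHomogeneous_sup_span {P : Ideal S} (hPh : P.IsHomogeneous 𝒮) {a : Fin d → ℕ} {x : S}
    (hx : x ∈ 𝒮 a) : (P ⊔ Ideal.span {x}).IsHomogeneous 𝒮 :=
  (isHomogSubmodule_iff_isHomogeneous 𝒮 _).mp
    (((isHomogSubmodule_iff_isHomogeneous 𝒮 P).mpr hPh).sup (isHomogSubmodule_span_singleton 𝒮 hx))

theorem lt_sup_span {P : Ideal S} {x : S} (hx : x ∉ P) : P < P ⊔ Ideal.span {x} :=
  lt_of_le_of_ne le_sup_left fun h =>
    hx (h ▸ Submodule.mem_sup_right (Submodule.mem_span_singleton_self x))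

variable (ℳ : (Fin d → ℕ) → Submodule A M) [DirectSum.Decomposition ℳ] [SetLike.GradedSMul 𝒮 ℳ]
  [Module.Finite S M]

theorem IsStandardGraded.length_ne_top [IsArtinianRing A] (hS : IsStandardGraded 𝒮)
    (n : Fin d → ℕ) : Module.length A (ℳ n) ≠ ⊤ :=
  have := hS.finite_component ℳ n
  Module.length_ne_top

/-- The Hilbert function of a finitely generated graded module over a standard graded algebra is
eventually a numerical polynomial. -/
theorem IsStandardGraded.exists_eventuallyBinomial [IsArtinianRing A] (hS : IsStandardGraded 𝒮) :
    ∃ e, EventuallyBinomial (hilbertFun A ℳ) e := by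
  have := hS.isNoetherianRing
  have hfin := hS.length_ne_top 𝒮
  refine devissage 𝒮 (C := fun f => ∃ e, EventuallyBinomial f e) hfin (hS.length_ne_top ℳ)
    ⟨0, Eventually.of_forall fun n => by simp⟩ ?_ ?_
  · rintro F G H a ⟨e, he⟩ ⟨e', he'⟩ h
    obtain ⟨e'', he''⟩ := he'.exists_comp_sub a
    exact ⟨_, (he.add he'').congr ((eventually_ge_atTop a).mono h)⟩
  · intro P hP hPh _ ih
    by_cases hi : ∃ i, ∀ s ∈ 𝒮 (Pi.single i 1), s ∈ P
    · obtain ⟨i, hi⟩ := hi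
      exact ⟨0, (hS.eventually_hilbertFun_eq_zero hi).mono fun n hn => by simp [hn]⟩
    · push Not at hi
      refine exists_eventuallyBinomial_of_backwardDiff fun i => ?_
      obtain ⟨x, hx, hxP⟩ := hi i
      obtain ⟨e, he⟩ := ih _ (isHomogeneous_sup_span hPh hx) (lt_sup_span hxP)
      exact ⟨e, he.congr (eventually_backwardDiff_prime hfin hPh hx hxP)⟩

variable (𝒮) in
/-- There are no chains `P < Q` of homogeneous primes that contain the ideal `K` but not `S_{++}`,
that is, the relevant part of `V(K)` has dimension at most zero. -/
def RelevantDimNonpos (K : Ideal S) : Prop :=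
  ∀ P Q : Ideal S, P.IsPrime → Q.IsPrime → P.IsHomogeneous 𝒮 → Q.IsHomogeneous 𝒮 → K ≤ P → P < Q →
    relevantIdeal 𝒮 ≤ Q

variable (𝒮) in
omit [Module A M] [IsScalarTower A S M] in
theorem dimRelevantSupport_quotient_nonpos_iff (I : Ideal S) :
    dimRelevantSupport 𝒮 (M ⧸ (I • (⊤ : Submodule S M))) ≤ 0 ↔
      RelevantDimNonpos 𝒮 (Module.annihilator S M ⊔ I) := by
  have hsupp : ∀ P : PrimeSpectrum S, P ∈ Module.support S (M ⧸ (I • (⊤ : Submodule S M))) ↔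
      Module.annihilator S M ⊔ I ≤ P.asIdeal := by
    intro P
    rw [Module.support_quotient, Set.mem_inter_iff, Module.mem_support_iff_of_finite,
      PrimeSpectrum.mem_zeroLocus, sup_le_iff]
    rfl
  rw [dimRelevantSupport, Order.krullDim_nonpos_iff_forall_isMax]
  constructor
  · intro h P Q hP hQ hPh hQh hK hlt
    by_contra hrel
    let p : relevantSupport 𝒮 (M ⧸ (I • (⊤ : Submodule S M))) :=
      ⟨⟨P, hP⟩, hPh, fun hle => hrel (hle.trans hlt.le), (hsupp ⟨P, hP⟩).mpr hK⟩
    let q : relevantSupport 𝒮 (M ⧸ (I • (⊤ : Submodule S M))) :=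
      ⟨⟨Q, hQ⟩, hQh, hrel, (hsupp ⟨Q, hQ⟩).mpr (hK.trans hlt.le)⟩
    have hpq : p ≤ q := hlt.le
    have hqp : q ≤ p := h p hpq
    exact hlt.not_ge hqp
  · rintro h ⟨P, hPh, hPr, hPs⟩ ⟨Q, hQh, hQr, hQs⟩ hle
    by_contra hne
    exact hQr (h P.asIdeal Q.asIdeal P.2 Q.2 hPh hQh ((hsupp P).mp hPs)
      (lt_of_le_not_ge hle hne))

theorem eventually_eq_zero_extension {F G H : (Fin d → ℕ) → ℤ} {a : Fin d → ℕ}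
    (hG : ∀ᶠ n in atTop, G n = 0) (hH : ∀ᶠ n in atTop, H n = 0)
    (hF : ∀ n, a ≤ n → F n = G n + H (n - a)) : ∀ᶠ n in atTop, F n = 0 := by
  filter_upwards [hG, (tendsto_sub_vector a).eventually hH, eventually_ge_atTop a] with n h1 h2 h3
  rw [hF n h3, h1, h2, add_zero]

/-- If the relevant support of `M` is empty, then `M_n = 0` for large `n`. -/
theorem IsStandardGraded.eventually_eq_zero [IsArtinianRing A] (hS : IsStandardGraded 𝒮)
    (h : ∀ P : Ideal S, P.IsPrime → P.IsHomogeneous 𝒮 → Module.annihilator S M ≤ P →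
      relevantIdeal 𝒮 ≤ P) : ∀ᶠ n in atTop, hilbertFun A ℳ n = 0 := by
  have := hS.isNoetherianRing
  refine devissage 𝒮 (C := fun f => ∀ᶠ n in atTop, f n = 0) (hS.length_ne_top 𝒮)
    (hS.length_ne_top ℳ) (Eventually.of_forall fun n => rfl)
    (fun F G H a => eventually_eq_zero_extension) fun P hP hPh hle _ => ?_
  obtain ⟨i, hi⟩ := exists_single_subset_of_relevantIdeal_le (h P hP hPh hle)
  exact hS.eventually_hilbertFun_eq_zero hi

theorem IsStandardGraded.eventually_quotient_eq_zero [IsArtinianRing A] (hS : IsStandardGraded 𝒮)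
    (I : Ideal S) (hI : I.IsHomogeneous 𝒮)
    (h : ∀ P : Ideal S, P.IsPrime → P.IsHomogeneous 𝒮 → I ≤ P → relevantIdeal 𝒮 ≤ P) :
    ∀ᶠ n in atTop, hilbertFun A (quotientGrading 𝒮 I) n = 0 := by
  have := hS.isNoetherianRing
  refine devissage_ideal 𝒮 (C := fun f => ∀ᶠ n in atTop, f n = 0) (hS.length_ne_top 𝒮)
    (Eventually.of_forall fun n => rfl) (fun F G H a => eventually_eq_zero_extension) I
    (fun P hP hPh hle _ => ?_) I hI le_rfl
  obtain ⟨i, hi⟩ := exists_single_subset_of_relevantIdeal_le (h P hP hPh hle)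
  exact hS.eventually_hilbertFun_eq_zero hi

/-- If the relevant support of `M` has dimension at most zero, then the Hilbert function of `M` is
eventually constant. -/
theorem IsStandardGraded.eventually_const [IsArtinianRing A] (hS : IsStandardGraded 𝒮)
    (h : RelevantDimNonpos 𝒮 (Module.annihilator S M)) :
    ∃ c, ∀ᶠ n in atTop, hilbertFun A ℳ n = c := by
  have := hS.isNoetherianRing
  have hfin := hS.length_ne_top 𝒮
  refine devissage 𝒮 (C := fun f => ∃ c, ∀ᶠ n in atTop, f n = c) hfin
    (hS.length_ne_top ℳ) ⟨0, Eventually.of_forall fun n => rfl⟩ ?_ ?_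
  · rintro F G H a ⟨c, hG⟩ ⟨c', hH⟩ hF
    refine ⟨c + c', ?_⟩
    filter_upwards [hG, (tendsto_sub_vector a).eventually hH, eventually_ge_atTop a]
      with n h1 h2 h3
    rw [hF n h3, h1, h2]
  · intro P hP hPh hle _
    by_cases hi : ∃ i, ∀ s ∈ 𝒮 (Pi.single i 1), s ∈ P
    · obtain ⟨i, hi⟩ := hi
      exact ⟨0, hS.eventually_hilbertFun_eq_zero hi⟩
    · push Not at hi
      refine eventually_const_of_backwardDiff fun i => ?_
      obtain ⟨x, hx, hxP⟩ := hi i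
      -- A relevant prime over `P + x S` would form a chain with `P`.
      have h0 := hS.eventually_quotient_eq_zero _ (isHomogeneous_sup_span hPh hx)
        fun Q hQ hQh hQle => h P Q hP hQ hPh hQh hle ((lt_sup_span hxP).trans_le hQle)
      filter_upwards [h0, eventually_backwardDiff_prime hfin hPh hx hxP] with n h1 h2
      rw [h2, h1]

omit [GradedAlgebra 𝒮] in
theorem one_le_hilbertFun_quotientGrading (hfin : ∀ n, Module.length A (𝒮 n) ≠ ⊤) {I : Ideal S}
    {n : Fin d → ℕ} {s : S} (hs : s ∈ 𝒮 n) (hsI : s ∉ I) :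
    1 ≤ hilbertFun A (quotientGrading 𝒮 I) n := by
  have hne : Module.length A (quotientGrading 𝒮 I n) ≠ 0 := by
    rw [Ne, Module.length_eq_zero_iff, Submodule.subsingleton_iff_eq_bot]
    intro h
    have : (Submodule.mkQ I) s ∈ quotientGrading 𝒮 I n := ⟨s, hs, rfl⟩
    rw [h, Submodule.mem_bot] at this
    exact hsI ((Submodule.Quotient.mk_eq_zero I).mp this)
  have hne' : (Module.length A (quotientGrading 𝒮 I n)).toNat ≠ 0 := by
    rw [Ne, ENat.toNat_eq_zero, not_or]
    exact ⟨hne, length_quotientGrading_ne_top hfin _ _⟩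
  rw [hilbertFun]
  exact_mod_cast Nat.one_le_iff_ne_zero.mpr hne'

/-- If `P < Q` are homogeneous primes with `S_{++} ⊄ Q`, then the Hilbert function of `S / P` grows
without bound along the multiples of the degree of a homogeneous element of `Q \ P`. -/
theorem IsStandardGraded.exists_unbounded (hS : IsStandardGraded 𝒮)
    (hfin : ∀ n, Module.length A (𝒮 n) ≠ ⊤) {P Q : Ideal S} [P.IsPrime] [Q.IsPrime]
    (hPh : P.IsHomogeneous 𝒮) (hQh : Q.IsHomogeneous 𝒮) (hlt : P < Q)
    (hQ : ¬ relevantIdeal 𝒮 ≤ Q) :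
    ∃ b : Fin d → ℕ, ∀ (t : ℕ) (n : Fin d → ℕ),
      (t : ℤ) ≤ hilbertFun A (quotientGrading 𝒮 P) (n + t • b) := by
  obtain ⟨z, hzQ, hzP⟩ := SetLike.exists_of_lt hlt
  obtain ⟨b, hb⟩ : ∃ b, homogProj 𝒮 b z ∉ P := by
    by_contra! h
    exact hzP (mem_of_homogProj_mem 𝒮 (T := P.toAddSubmonoid) h)
  refine ⟨b, fun t => ?_⟩
  induction t with
  | zero => intro n; simp [hilbertFun]
  | succ t ih =>
    intro n
    have hstep := hilbertFun_prime_add hfin hPh (homogProj_mem 𝒮 b z) hb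
      (n := n + (t + 1) • b) (by rw [add_smul, one_smul, ← add_assoc]; exact le_add_self)
    have hsub : n + (t + 1) • b - b = n + t • b := by
      rw [add_smul, one_smul, ← add_assoc, add_tsub_cancel_right]
    obtain ⟨s, hs, hsQ⟩ := hS.exists_component_notMem hQ (n + (t + 1) • b)
    have hle : P ⊔ Ideal.span {homogProj 𝒮 b z} ≤ Q :=
      sup_le hlt.le ((Ideal.span_singleton_le_iff_mem Q).mpr (hQh b hzQ))
    have h1 := one_le_hilbertFun_quotientGrading hfin hs (fun h => hsQ (hle h))
    have h2 := ih n
    rw [hstep, hsub]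
    push_cast
    linarith

/-- If the Hilbert function of `M` is eventually constant, then the relevant support of `M` has
dimension at most zero. -/
theorem IsStandardGraded.relevantDimNonpos_of_eventually_const [IsArtinianRing A]
    (hS : IsStandardGraded 𝒮) {c : ℤ} (hc : ∀ᶠ n in atTop, hilbertFun A ℳ n = c) :
    RelevantDimNonpos 𝒮 (Module.annihilator S M) := by
  intro P Q hP hQ hPh hQh hle hlt
  by_contra hrel
  have hfin := hS.length_ne_top 𝒮
  have hsupp : (⟨P, hP⟩ : PrimeSpectrum S) ∈ Module.support S M :=
    Module.mem_support_iff_of_finite.mpr hle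
  obtain ⟨m, hm, hmP⟩ := (Module.mem_support_iff_of_span_eq_top (span_components_eq_top S ℳ)).mp hsupp
  obtain ⟨a, ha⟩ := Set.mem_iUnion.mp hm
  -- The Hilbert function of `S / P` is bounded by that of `S m ≅ S / Ann m`.
  have hbound : ∀ n, hilbertFun A (quotientGrading 𝒮 P) n ≤ hilbertFun A ℳ (n + a) := by
    intro n
    let φ : S →ₗ[A] M := (LinearMap.toSpanSingleton S M m).restrictScalars A
    have h1 : Module.length A ((𝒮 n).map φ) ≤ Module.length A (ℳ (n + a)) := by
      have hle : (𝒮 n).map φ ≤ ℳ (n + a) := by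
        rintro _ ⟨s, hs, rfl⟩
        exact smul_mem_graded hs ha
      exact Module.length_le_of_injective (Submodule.inclusion hle)
        (Submodule.inclusion_injective hle)
    have h2 : Module.length A (quotientGrading 𝒮 P n) ≤ Module.length A ((𝒮 n).map φ) := by
      have e1 := length_eq_inf_ker_add_map (P.mkQ.restrictScalars A) (𝒮 n)
      have e2 := length_eq_inf_ker_add_map φ (𝒮 n)
      have e3 : Module.length A ↥(𝒮 n ⊓ LinearMap.ker φ) ≤
          Module.length A ↥(𝒮 n ⊓ LinearMap.ker (P.mkQ.restrictScalars A)) := by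
        have hle : 𝒮 n ⊓ LinearMap.ker φ ≤ 𝒮 n ⊓ LinearMap.ker (P.mkQ.restrictScalars A) := by
          refine le_inf inf_le_left fun s hs => ?_
          refine (Submodule.Quotient.mk_eq_zero P).mpr (hmP ?_)
          exact (Submodule.mem_annihilator_span_singleton m s).mpr hs.2
        exact Module.length_le_of_injective (Submodule.inclusion hle)
          (Submodule.inclusion_injective hle)
      have e4 : Module.length A ↥(𝒮 n ⊓ LinearMap.ker (P.mkQ.restrictScalars A)) ≠ ⊤ := by
        intro h
        rw [h, top_add] at e1
        exact hfin n e1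
      rw [e1] at e2
      refine (ENat.add_le_add_iff_left e4).mp ?_
      change _ + Module.length A (Submodule.map (P.mkQ.restrictScalars A) (𝒮 n)) ≤ _
      rw [e2]
      gcongr
    rw [hilbertFun, hilbertFun]
    exact_mod_cast ENat.toNat_le_toNat (h2.trans h1) (hS.length_ne_top ℳ _)
  obtain ⟨n₀, hn₀⟩ := eventually_ge_vector hc
  obtain ⟨b, hb⟩ := hS.exists_unbounded hfin hPh hQh hlt hrel
  have h1 := hb (c.toNat + 1) n₀
  have h2 := hbound (n₀ + (c.toNat + 1) • b)
  rw [hn₀ _ (by rw [add_assoc]; exact le_self_add)] at h2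
  have h3 := Int.self_le_toNat c
  push_cast at h1
  linarith

end Relevant

/-! ### Avoidance of proper submodules -/

section Avoidance

/-- A module over a local ring with infinite residue field is not a finite union of proper
submodules. -/
theorem exists_notMem_of_ne_top {A : Type*} [CommRing A] [IsLocalRing A]
    [Infinite (IsLocalRing.ResidueField A)] {V : Type*} [AddCommGroup V] [Module A V]
    {ι : Type*} (s : Finset ι) (p : ι → Submodule A V) (hp : ∀ j ∈ s, p j ≠ ⊤) :
    ∃ x, ∀ j ∈ s, x ∉ p j := by
  by_contra! h
  -- In a finite cover some submodule `p j` has finite index, so a nonzero element of `V / p j`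
  -- makes a proper quotient of `A`, hence the residue field, finite.
  obtain ⟨j, hj, hfi⟩ := Submodule.exists_finiteIndex_of_cover (p := p) (s := s) (by
    rw [Set.eq_univ_iff_forall]
    intro x
    obtain ⟨j, hj, hx⟩ := h x
    exact Set.mem_biUnion hj hx)
  have : Finite (V ⧸ p j) := AddSubgroup.finite_quotient_of_finiteIndex
  have : Nontrivial (V ⧸ p j) := Submodule.Quotient.nontrivial_iff.mpr (hp j hj)
  obtain ⟨w, hw⟩ := exists_ne (0 : V ⧸ p j)
  let φ : A →ₗ[A] V ⧸ p j := LinearMap.toSpanSingleton A _ w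
  have hker : LinearMap.ker φ ≤ IsLocalRing.maximalIdeal A := by
    refine IsLocalRing.le_maximalIdeal fun htop => hw ?_
    have : (1 : A) ∈ LinearMap.ker φ := by rw [htop]; trivial
    simpa [φ] using this
  have : Finite (A ⧸ LinearMap.ker φ) := Finite.of_injective _ (LinearMap.ker_eq_bot.mp
    (Submodule.ker_liftQ_eq_bot _ φ le_rfl le_rfl))
  have : Finite (IsLocalRing.ResidueField A) :=
    Finite.of_surjective _ (Ideal.Quotient.factor_surjective hker)
  exact not_finite (IsLocalRing.ResidueField A)

end Avoidance

/-! ### The gradings of `M / x M` and of `0_M : x` -/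

section GradedInstances

variable {d : ℕ} {A : Type u} {S : Type v} {M : Type w} [CommRing A] [CommRing S] [Algebra A S]
  [AddCommGroup M] [Module A M] [Module S M] [IsScalarTower A S M]
  {𝒮 : (Fin d → ℕ) → Submodule A S}
  (ℳ : (Fin d → ℕ) → Submodule A M) [DirectSum.Decomposition ℳ] [SetLike.GradedSMul 𝒮 ℳ]

omit [DirectSum.Decomposition ℳ] in
variable (𝒮) in
theorem gradedSMul_quotGrading (x : S) : SetLike.GradedSMul 𝒮 (quotGrading A x ℳ) where
  smul_mem := by
    rintro i j s _ hs ⟨m, hm, rfl⟩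
    exact ⟨s • m, smul_mem_graded hs hm, rfl⟩

omit [DirectSum.Decomposition ℳ] in
variable (𝒮) in
theorem gradedSMul_annGrading (x : S) : SetLike.GradedSMul 𝒮 (annGrading A x ℳ) where
  smul_mem := by
    intro i j s m hs hm
    exact smul_mem_graded (ℳ := ℳ) hs hm

theorem nonempty_decomposition_quotGrading {a : Fin d → ℕ} {x : S} (hx : x ∈ 𝒮 a) :
    Nonempty (DirectSum.Decomposition (quotGrading A x ℳ)) := by
  set N : Submodule S M := Ideal.span {x} • ⊤ with hN
  have hNh : IsHomogSubmodule ℳ N := isHomogSubmodule_smul_top ℳ hx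
  let p : (Fin d → ℕ) → (M ⧸ N) →ₗ[A] (M ⧸ N) := fun n =>
    Submodule.mapQ (N.restrictScalars A) (N.restrictScalars A) (homogProj ℳ n)
      (fun m hm => hNh n m hm)
  have hp : ∀ n m, p n (N.mkQ m) = N.mkQ (homogProj ℳ n m) := fun n m => rfl
  refine nonempty_decomposition_of_proj _ p ?_ ?_ ?_
  · rintro n _ ⟨m, hm, rfl⟩
    exact (hp n m).trans (by rw [homogProj_of_mem hm]; rfl)
  · rintro n n' hne _ ⟨m, hm, rfl⟩
    exact (hp n' m).trans (by rw [homogProj_of_mem_ne hm hne, map_zero])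
  · change ⨆ n, (ℳ n).map (N.mkQ.restrictScalars A) = ⊤
    rw [← Submodule.map_iSup, iSup_eq_top_of_decomposition, Submodule.map_top]
    exact LinearMap.range_eq_top.mpr N.mkQ_surjective

theorem nonempty_decomposition_annGrading {a : Fin d → ℕ} {x : S} (hx : x ∈ 𝒮 a) :
    Nonempty (DirectSum.Decomposition (annGrading A x ℳ)) := by
  have hNh : IsHomogSubmodule ℳ (Submodule.torsionBy S M x) := isHomogSubmodule_torsionBy ℳ hx
  let p : (Fin d → ℕ) → Submodule.torsionBy S M x →ₗ[A] Submodule.torsionBy S M x := fun n =>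
    (homogProj ℳ n).restrict (p := (Submodule.torsionBy S M x).restrictScalars A)
      (q := (Submodule.torsionBy S M x).restrictScalars A) (fun m hm => hNh n m hm)
  have hp : ∀ n m, (p n m : M) = homogProj ℳ n m := fun n m => rfl
  refine nonempty_decomposition_of_proj _ p ?_ ?_ ?_
  · intro n m hm
    exact Subtype.ext ((hp n m).trans (homogProj_of_mem hm))
  · intro n n' hne m hm
    exact Subtype.ext ((hp n' m).trans (homogProj_of_mem_ne hm hne))
  · rw [eq_top_iff]
    intro m _
    classical
    have hm : m = ∑ n ∈ (DirectSum.decompose ℳ (m : M)).support, p n m := by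
      apply Subtype.ext
      rw [AddSubmonoidClass.coe_finsetSum]
      exact (DirectSum.sum_support_decompose ℳ (m : M)).symm
    rw [hm]
    exact sum_mem fun n _ => Submodule.mem_iSup_of_mem n (homogProj_mem ℳ n m)

omit [DirectSum.Decomposition ℳ] in
theorem length_annGrading (x : S) (n : Fin d → ℕ) :
    Module.length A (annGrading A x ℳ n) =
      Module.length A ↥(ℳ n ⊓ LinearMap.ker ((LinearMap.lsmul S M x).restrictScalars A)) := by
  rw [← length_map_injective ((Submodule.torsionBy S M x).subtype.restrictScalars A)
    (Submodule.subtype_injective _)]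
  suffices h : (annGrading A x ℳ n).map ((Submodule.torsionBy S M x).subtype.restrictScalars A) =
      ℳ n ⊓ LinearMap.ker ((LinearMap.lsmul S M x).restrictScalars A) by rw [h]
  ext m
  constructor
  · rintro ⟨t, ht, rfl⟩
    exact ⟨ht, (Submodule.mem_torsionBy_iff x _).mp t.2⟩
  · rintro ⟨h1, h2⟩
    exact ⟨⟨m, (Submodule.mem_torsionBy_iff x _).mpr h2⟩, h1, rfl⟩

/-- Lengths in the exact sequence `0 → (0_M : x)(-a) → M(-a) → M → M / x M → 0`. -/
theorem hilbertFun_sub_eq (hfin : ∀ n, Module.length A (ℳ n) ≠ ⊤) {a : Fin d → ℕ} {x : S}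
    (hx : x ∈ 𝒮 a) {n : Fin d → ℕ} (hn : a ≤ n) :
    hilbertFun A ℳ n - hilbertFun A ℳ (n - a) =
      hilbertFun A (quotGrading A x ℳ) n - hilbertFun A (annGrading A x ℳ) (n - a) := by
  obtain ⟨b, rfl⟩ := exists_add_of_le hn
  rw [add_tsub_cancel_left]
  set N : Submodule S M := Ideal.span {x} • ⊤ with hN
  let μ : M →ₗ[A] M := (LinearMap.lsmul S M x).restrictScalars A
  have h1 := length_eq_inf_ker_add_map μ (ℳ b)
  have h2 := length_eq_inf_ker_add_map (N.mkQ.restrictScalars A) (ℳ (a + b))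
  have h3 : ℳ (a + b) ⊓ LinearMap.ker (N.mkQ.restrictScalars A) = (ℳ b).map μ := by
    ext m
    constructor
    · rintro ⟨hm, hm'⟩
      have hm'' : m ∈ N := (Submodule.Quotient.mk_eq_zero N).mp hm'
      rw [hN, Submodule.ideal_span_singleton_smul] at hm''
      obtain ⟨y, -, rfl⟩ := (Submodule.mem_smul_pointwise_iff_exists _ _ _).mp hm''
      refine ⟨homogProj ℳ b y, homogProj_mem _ _ _, ?_⟩
      rw [← homogProj_of_mem hm, homogProj_smul ℳ hx]
      rfl
    · rintro ⟨y, hy, rfl⟩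
      refine ⟨smul_mem_graded hx hy, (Submodule.Quotient.mk_eq_zero N).mpr ?_⟩
      exact Submodule.smul_mem_smul (Ideal.mem_span_singleton_self x) Submodule.mem_top
  rw [h3] at h2
  have h4 := length_annGrading ℳ x b
  change Module.length A (annGrading A x ℳ b) = Module.length A ↥(ℳ b ⊓ LinearMap.ker μ) at h4
  rw [← h4] at h1
  change _ = _ + Module.length A (quotGrading A x ℳ (a + b)) at h2
  have f1 := hfin b
  have f2 := hfin (a + b)
  rw [h1] at f1
  rw [h2] at f2
  rw [Ne, ENat.add_eq_top, not_or] at f1 f2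
  simp only [hilbertFun]
  rw [h1, h2, ENat.toNat_add f1.1 f1.2, ENat.toNat_add f2.1 f2.2]
  push_cast
  ring

end GradedInstances

/-! ### Filter-regular elements -/

section FilterRegular

variable {d : ℕ} {A : Type u} {S : Type v} {M : Type w} [CommRing A] [CommRing S] [Algebra A S]
  [AddCommGroup M] [Module A M] [Module S M] [IsScalarTower A S M]
  {𝒮 : (Fin d → ℕ) → Submodule A S} [GradedAlgebra 𝒮]
  (ℳ : (Fin d → ℕ) → Submodule A M) [DirectSum.Decomposition ℳ] [SetLike.GradedSMul 𝒮 ℳ]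
  [Module.Finite S M]

/-- For an infinite residue field every `S_i` contains a filter-regular element `x`: one that avoids
the associated primes of `M` that do not contain `S_i`. The relevant support of `0_M : x` is empty,
because a minimal prime of `0_M : x` is an associated prime of `M` that contains `x`. -/
theorem IsStandardGraded.exists_filterRegular [IsLocalRing A] [IsArtinianRing A]
    [Infinite (IsLocalRing.ResidueField A)] (hS : IsStandardGraded 𝒮) (i : Fin d) :
    ∃ x ∈ 𝒮 (Pi.single i 1), ∀ᶠ n in atTop, hilbertFun A (annGrading A x ℳ) n = 0 := by
  classical
  have := hS.isNoetherianRing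
  have : IsNoetherian S M := isNoetherian_of_isNoetherianRing_of_finite S M
  let B : Finset (Ideal S) := (associatedPrimes.finite S M).toFinset.filter
    fun P => ¬ ∀ s ∈ 𝒮 (Pi.single i 1), s ∈ P
  obtain ⟨⟨x, hx⟩, hxB⟩ := exists_notMem_of_ne_top (V := 𝒮 (Pi.single i 1)) B
    (fun P => (Submodule.restrictScalars A P).comap (𝒮 (Pi.single i 1)).subtype) (by
      intro P hP htop
      refine (Finset.mem_filter.mp hP).2 fun s hs => ?_
      have : (⟨s, hs⟩ : 𝒮 (Pi.single i 1)) ∈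
        (Submodule.restrictScalars A P).comap (𝒮 (Pi.single i 1)).subtype := by
          rw [htop]; trivial
      exact this)
  refine ⟨x, hx, ?_⟩
  obtain ⟨_⟩ := nonempty_decomposition_annGrading ℳ hx
  have := gradedSMul_annGrading 𝒮 ℳ x
  refine hS.eventually_eq_zero (annGrading A x ℳ) fun Q hQ _ hle => ?_
  by_contra hrel
  obtain ⟨P, hPmin, hPQ⟩ := Ideal.exists_minimalPrimes_le hle
  have hPass : P ∈ associatedPrimes S M :=
    associatedPrimes.subset_of_injective (Submodule.subtype_injective (Submodule.torsionBy S M x))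
      (Module.associatedPrimes.minimalPrimes_annihilator_subset_associatedPrimes S _ hPmin)
  have hPB : P ∈ B := by
    refine Finset.mem_filter.mpr ⟨(Set.Finite.mem_toFinset _).mpr hPass, fun h => hrel ?_⟩
    exact (hS.relevantIdeal_le h).trans hPQ
  refine hxB P hPB (hPmin.1.2 ?_)
  rw [Module.mem_annihilator]
  exact fun t => Subtype.ext ((Submodule.mem_torsionBy_iff x _).mp t.2)

end FilterRegular

/-! ### Recursion along a mixed multiplicity system -/

section Recursion

variable {d : ℕ} {A : Type u} {S : Type v} [CommRing A] [CommRing S] [Algebra A S]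

theorem eventualValue_eq {f : (Fin d → ℕ) → ℤ} {c : ℤ} (h : ∀ᶠ n in atTop, f n = c) :
    eventualValue f = c := by
  have hex : ∃ a, ∀ᶠ n in atTop, f n = a := ⟨c, h⟩
  rw [eventualValue, dif_pos hex]
  obtain ⟨n, h1, h2⟩ := (hex.choose_spec.and h).exists
  exact h1.symm.trans h2

theorem eventuallyBinomial_const {f : (Fin d → ℕ) → ℤ} {c : ℤ} (h : ∀ᶠ n in atTop, f n = c) :
    EventuallyBinomial f (Finsupp.single 0 c) :=
  h.mono fun n hn => by simp [hn]

theorem RelevantDimNonpos.mono {𝒮 : (Fin d → ℕ) → Submodule A S} [GradedAlgebra 𝒮]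
    {K K' : Ideal S} (h : RelevantDimNonpos 𝒮 K) (hle : K ≤ K') : RelevantDimNonpos 𝒮 K' :=
  fun P Q hP hQ hPh hQh hK hlt => h P Q hP hQ hPh hQh (hle.trans hK) hlt

theorem koszulDegree_univ_succ {r : ℕ} (c : Fin (r + 1) → Fin d) :
    koszulDegree c Finset.univ = koszulDegree (Fin.tail c) Finset.univ + Pi.single (c 0) 1 := by
  rw [koszulDegree, Fin.sum_univ_succ, add_comm]
  rfl

section Module

variable {M : Type w} [AddCommGroup M] [Module A M] [Module S M] [IsScalarTower A S M]
  {𝒮 : (Fin d → ℕ) → Submodule A S}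
  (ℳ : (Fin d → ℕ) → Submodule A M) [DirectSum.Decomposition ℳ] [SetLike.GradedSMul 𝒮 ℳ]

/-- The coefficients of `M`, `M / x M` and `0_M : x` for `x ∈ S_i`. -/
theorem coeff_add_single (hfin : ∀ n, Module.length A (ℳ n) ≠ ⊤) {i : Fin d} {x : S}
    (hx : x ∈ 𝒮 (Pi.single i 1)) {e eQ eT : (Fin d → ℕ) →₀ ℤ}
    (he : EventuallyBinomial (hilbertFun A ℳ) e)
    (hQ : EventuallyBinomial (hilbertFun A (quotGrading A x ℳ)) eQ)
    (hT : EventuallyBinomial (hilbertFun A (annGrading A x ℳ)) eT) (h : Fin d → ℕ) :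
    e (h + Pi.single i 1) = eQ h - eT h + eT (h + Pi.single i 1) := by
  have h1 := he.backwardDiff i
  have h2 := hQ.sub (hT.comp_sub_single i)
  have h3 := h1.unique (h2.congr ((eventually_ge_atTop (Pi.single i 1)).mono fun n hn =>
    hilbertFun_sub_eq ℳ hfin hx hn))
  have h4 := DFunLike.congr_fun h3 h
  simp only [coeffShift_apply, Finsupp.coe_sub, Pi.sub_apply] at h4
  rw [h4]
  ring

end Module

variable [IsArtinianRing A] {𝒮 : (Fin d → ℕ) → Submodule A S} [GradedAlgebra 𝒮]

/-- A mixed multiplicity system of type `k` forces `e(M; h) = 0` for all `h > k`, and its mixed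
multiplicity symbol is well defined with the value `e(M; k)`. Both `M / x₁ M` and `0_M : x₁` have
`x₂, …, x_r` as a system, since `x₁` annihilates them. -/
theorem IsStandardGraded.mixedSymbol_eq (hS : IsStandardGraded 𝒮) (r : ℕ) :
    ∀ (x : Fin r → S) (c : Fin r → Fin d) (M : Type w) [AddCommGroup M] [Module A M] [Module S M]
      [IsScalarTower A S M] [Module.Finite S M] (ℳ : (Fin d → ℕ) → Submodule A M)
      [DirectSum.Decomposition ℳ] [SetLike.GradedSMul 𝒮 ℳ] (e : (Fin d → ℕ) →₀ ℤ),
      (∀ j, x j ∈ 𝒮 (Pi.single (c j) 1)) →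
      RelevantDimNonpos 𝒮 (Module.annihilator S M ⊔ Ideal.span (Set.range x)) →
      EventuallyBinomial (hilbertFun A ℳ) e →
      MixedSymbolDefined A r x M ℳ ∧ mixedSymbol A r x M ℳ = e (koszulDegree c Finset.univ) ∧
        ∀ h, koszulDegree c Finset.univ < h → e h = 0 := by
  have := hS.isNoetherianRing
  induction r with
  | zero =>
    intro x c M _ _ _ _ _ ℳ _ _ e _ hdim he
    have hspan : Ideal.span (Set.range x) = ⊥ := by
      rw [Set.range_eq_empty, Ideal.span_empty]
    rw [hspan, sup_bot_eq] at hdim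
    obtain ⟨a, ha⟩ := hS.eventually_const ℳ hdim
    obtain rfl := he.unique (eventuallyBinomial_const ha)
    have h0 : koszulDegree c Finset.univ = 0 := by simp [koszulDegree]
    rw [h0]
    refine ⟨⟨a.toNat, ha.mono fun n hn => ?_⟩, ?_, fun h hh => ?_⟩
    · rw [← hn, hilbertFun, Int.toNat_natCast, ENat.natCast_toNat (hS.length_ne_top ℳ n)]
    · rw [Finsupp.single_eq_same]
      exact eventualValue_eq ha
    · exact Finsupp.single_eq_of_ne hh.ne'
  | succ r ih =>
    intro x c M _ _ _ _ _ ℳ _ _ e hx hdim he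
    have : IsNoetherian S M := isNoetherian_of_isNoetherianRing_of_finite S M
    obtain ⟨_⟩ := nonempty_decomposition_quotGrading ℳ (hx 0)
    obtain ⟨_⟩ := nonempty_decomposition_annGrading ℳ (hx 0)
    have := gradedSMul_quotGrading 𝒮 ℳ (x 0)
    have := gradedSMul_annGrading 𝒮 ℳ (x 0)
    obtain ⟨eQ, hQ⟩ := hS.exists_eventuallyBinomial (quotGrading A (x 0) ℳ)
    obtain ⟨eT, hT⟩ := hS.exists_eventuallyBinomial (annGrading A (x 0) ℳ)
    have hrange : Ideal.span (Set.range x) = Ideal.span {x 0} ⊔ Ideal.span (Set.range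
        (Fin.tail x)) := by
      rw [← Ideal.span_union]
      congr 1
      rw [← Fin.cons_self_tail x, Fin.range_cons]
      simp
    have hle : ∀ K : Ideal S, Module.annihilator S M ≤ K → x 0 ∈ K →
        RelevantDimNonpos 𝒮 (K ⊔ Ideal.span (Set.range (Fin.tail x))) := fun K h1 h2 =>
      hdim.mono (sup_le (h1.trans le_sup_left) (hrange.trans_le
        (sup_le_sup_right ((Ideal.span_singleton_le_iff_mem K).mpr h2) _)))
    obtain ⟨q1, q2, q3⟩ := ih (Fin.tail x) (Fin.tail c) _ (quotGrading A (x 0) ℳ) eQ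
      (fun j => hx j.succ) (hle _ (LinearMap.annihilator_le_of_surjective _
        (Submodule.mkQ_surjective _)) (by
          rw [Module.mem_annihilator]
          intro y
          obtain ⟨m, rfl⟩ := Submodule.mkQ_surjective _ y
          rw [← map_smul]
          exact (Submodule.Quotient.mk_eq_zero _).mpr
            (Submodule.smul_mem_smul (Ideal.mem_span_singleton_self _) Submodule.mem_top))) hQ
    obtain ⟨t1, t2, t3⟩ := ih (Fin.tail x) (Fin.tail c) _ (annGrading A (x 0) ℳ) eT
      (fun j => hx j.succ) (hle _ (LinearMap.annihilator_le_of_injective _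
        (Submodule.subtype_injective _)) (by
          rw [Module.mem_annihilator]
          exact fun t => Subtype.ext ((Submodule.mem_torsionBy_iff _ _).mp t.2))) hT
    have hcoeff := coeff_add_single ℳ (hS.length_ne_top ℳ) (hx 0) he hQ hT
    have hlt : ∀ g : Fin d → ℕ, g < g + Pi.single (c 0) 1 := fun g =>
      lt_of_le_of_ne le_self_add fun h => by simpa using congrFun h (c 0)
    rw [koszulDegree_univ_succ]
    -- The third term of `hcoeff` vanishes: its index exceeds the type of `x₂, …, x_r`.
    refine ⟨⟨q1, t1⟩, ?_, fun h hh => ?_⟩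
    · rw [hcoeff, t3 _ (hlt _), add_zero, ← q2, ← t2]
      rfl
    · obtain ⟨g, rfl⟩ := exists_eq_add_single (i := c 0) (g := h)
        (fun h0 => by simpa [h0] using hh.le (c 0))
      have hg := lt_of_add_lt_add_right hh
      rw [hcoeff, q3 g hg, t3 g hg, t3 _ (hg.trans (hlt g)), sub_zero, add_zero]

/-- If `e(M; h) = 0` for all `h > k`, then successive filter-regular elements form a mixed
multiplicity system of type `k`: modulo a filter-regular element of `S_i` the coefficients are
shifted by the `i`-th unit vector, so in the end only the constant coefficient remains. -/
theorem IsStandardGraded.exists_system [IsLocalRing A] [Infinite (IsLocalRing.ResidueField A)]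
    (hS : IsStandardGraded 𝒮) (N : ℕ) :
    ∀ (M : Type w) [AddCommGroup M] [Module A M] [Module S M]
      [IsScalarTower A S M] [Module.Finite S M] (ℳ : (Fin d → ℕ) → Submodule A M)
      [DirectSum.Decomposition ℳ] [SetLike.GradedSMul 𝒮 ℳ] (e : (Fin d → ℕ) →₀ ℤ)
      (k : Fin d → ℕ), ∑ i, k i = N → EventuallyBinomial (hilbertFun A ℳ) e →
      (∀ h, k < h → e h = 0) →
      ∃ (r : ℕ) (x : Fin r → S) (c : Fin r → Fin d), (∀ j, x j ∈ 𝒮 (Pi.single (c j) 1)) ∧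
        koszulDegree c Finset.univ = k ∧
        RelevantDimNonpos 𝒮 (Module.annihilator S M ⊔ Ideal.span (Set.range x)) := by
  induction N with
  | zero =>
    intro M _ _ _ _ _ ℳ _ _ e k hk he hzero
    have hk0 : k = 0 := by
      ext i
      exact (Finset.sum_eq_zero_iff.mp hk) i (Finset.mem_univ i)
    subst hk0
    refine ⟨0, Fin.elim0, Fin.elim0, fun j => j.elim0, by simp [koszulDegree], ?_⟩
    have hes : e = Finsupp.single 0 (e 0) := by
      classical
      ext h
      rw [Finsupp.single_apply]
      split_ifs with hh
      · rw [hh]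
      · exact hzero h (lt_of_le_of_ne zero_le hh)
    rw [hes] at he
    exact (hS.relevantDimNonpos_of_eventually_const ℳ (c := e 0)
      (he.mono fun n hn => by simpa using hn)).mono le_sup_left
  | succ N ih =>
    intro M _ _ _ _ _ ℳ _ _ e k hk he hzero
    obtain ⟨i, -, hi⟩ : ∃ i ∈ Finset.univ, k i ≠ 0 := by
      by_contra! h
      rw [Finset.sum_eq_zero h] at hk
      omega
    obtain ⟨k, rfl⟩ := exists_eq_add_single hi
    obtain ⟨y, hy, hyT⟩ := hS.exists_filterRegular ℳ i
    obtain ⟨_⟩ := nonempty_decomposition_quotGrading ℳ hy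
    have := gradedSMul_quotGrading 𝒮 ℳ y
    obtain ⟨eQ, hQ⟩ := hS.exists_eventuallyBinomial (quotGrading A y ℳ)
    have hT : EventuallyBinomial (hilbertFun A (annGrading A y ℳ)) 0 :=
      hyT.mono fun n hn => by simp [hn]
    have hcoeff := coeff_add_single ℳ (hS.length_ne_top ℳ) hy he hQ hT
    simp only [Finsupp.coe_zero, Pi.zero_apply, sub_zero, add_zero] at hcoeff
    obtain ⟨r, x, c, hx, hdeg, hdim⟩ := ih _ (quotGrading A y ℳ) eQ k
      (by simpa [Finset.sum_add_distrib, Finset.sum_pi_single] using hk) hQ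
      (fun h hh => by rw [← hcoeff]; exact hzero _ (add_lt_add_left hh _))
    refine ⟨r + 1, Fin.cons y x, Fin.cons i c, fun j => ?_, ?_, ?_⟩
    · refine Fin.cases ?_ (fun j => ?_) j
      · exact hy
      · exact hx j
    · rw [koszulDegree_univ_succ, Fin.tail_cons, hdeg, Fin.cons_zero]
    · intro P Q hP hQ' hPh hQh hle hlt
      refine hdim P Q hP hQ' hPh hQh ?_ hlt
      rw [sup_le_iff] at hle ⊢
      have hrange : Set.range x ⊆ Set.range (Fin.cons y x : Fin (r + 1) → S) := by
        rintro _ ⟨j, rfl⟩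
        exact ⟨j.succ, rfl⟩
      refine ⟨?_, (Ideal.span_mono hrange).trans hle.2⟩
      have hyP : y ∈ P := hle.2 (Ideal.subset_span ⟨0, rfl⟩)
      have hsupp : (⟨P, hP⟩ : PrimeSpectrum S) ∈
          Module.support S (M ⧸ (Ideal.span {y} • (⊤ : Submodule S M))) := by
        rw [Module.support_quotient]
        refine ⟨Module.mem_support_iff_of_finite.mpr hle.1, ?_⟩
        rw [PrimeSpectrum.mem_zeroLocus]
        exact (Ideal.span_singleton_le_iff_mem P).mpr hyP
      exact Module.mem_support_iff_of_finite.mp hsupp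

end Recursion

/-! ### The Euler–Poincaré characteristic of the Koszul complex -/

section Koszul

variable {d : ℕ} {A : Type u} {S : Type v} {M : Type w} [CommRing A] [CommRing S] [Algebra A S]
  [AddCommGroup M] [Module A M] [Module S M] [IsScalarTower A S M]

omit [Algebra A S] [Module A M] [IsScalarTower A S M] in
theorem koszulDifferential_apply {r : ℕ} (x : Fin r → S) (f : Finset (Fin r) → M)
    (J : Finset (Fin r)) :
    koszulDifferential x f J =
      ∑ j ∈ Jᶜ, ((-1 : S) ^ (J.filter fun l => l < j).card * x j) • f (insert j J) := by
  simp [koszulDifferential]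

omit [Algebra A S] [Module A M] [IsScalarTower A S M] in
/-- The Koszul differential squares to zero: the terms for `(j, l)` and `(l, j)` cancel. -/
theorem koszulDifferential_comp_self {r : ℕ} (x : Fin r → S) (f : Finset (Fin r) → M) :
    koszulDifferential x (koszulDifferential x f) = 0 := by
  ext J
  rw [koszulDifferential_apply]
  simp only [koszulDifferential_apply, Finset.smul_sum, Pi.zero_apply]
  rw [Finset.sum_sigma']
  refine Finset.sum_involution (fun p _ => ⟨p.2, p.1⟩) ?_ ?_ ?_ ?_
  · rintro ⟨j, l⟩ hp
    simp only [Finset.mem_sigma, Finset.mem_compl, Finset.mem_insert, not_or] at hp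
    obtain ⟨hj, hlj, hl⟩ := hp
    simp only [smul_smul, Finset.insert_comm l j J, Finset.filter_insert]
    rw [← add_smul]
    suffices hs : ∀ j l : Fin r, j ∉ J → l ∉ J → j < l →
        ((-1 : S) ^ (J.filter fun i => i < j).card * x j) *
          ((-1) ^ (if j < l then insert j (J.filter fun i => i < l)
            else J.filter fun i => i < l).card * x l) +
        ((-1 : S) ^ (J.filter fun i => i < l).card * x l) *
          ((-1) ^ (if l < j then insert l (J.filter fun i => i < j)
            else J.filter fun i => i < j).card * x j) = 0 by
      rcases lt_or_gt_of_ne hlj with h | h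
      · rw [add_comm, hs l j hl hj h, zero_smul]
      · rw [hs j l hj hl h, zero_smul]
    -- For `j < l` adding `j` to `J` changes the sign that belongs to `l`, but not conversely.
    intro j l hj hl hjl
    rw [if_pos hjl, if_neg hjl.not_gt, Finset.card_insert_of_notMem (by simp [hj]), pow_succ]
    ring
  · rintro ⟨j, l⟩ hp _ heq
    simp only [Finset.mem_sigma, Finset.mem_compl, Finset.mem_insert, not_or] at hp
    simp only [Sigma.mk.injEq] at heq
    exact hp.2.1 heq.1
  · rintro ⟨j, l⟩ hp
    simp only [Finset.mem_sigma, Finset.mem_compl, Finset.mem_insert, not_or] at hp ⊢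
    exact ⟨hp.2.2, fun h => hp.2.1 h.symm, hp.1⟩
  · rintro ⟨j, l⟩ _
    rfl

theorem koszulDegree_insert {r : ℕ} (c : Fin r → Fin d) {j : Fin r} {J : Finset (Fin r)}
    (hj : j ∉ J) : koszulDegree c (insert j J) = koszulDegree c J + Pi.single (c j) 1 := by
  rw [koszulDegree, Finset.sum_insert hj, add_comm]
  rfl

variable (ℳ : (Fin d → ℕ) → Submodule A M)

omit [Module S M] [IsScalarTower A S M] in
theorem mem_koszulComponent {r : ℕ} {c : Fin r → Fin d} {i : ℕ} {n : Fin d → ℕ}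
    {f : Finset (Fin r) → M} : f ∈ koszulComponent A ℳ c i n ↔
      ∀ I, (I.card = i ∧ koszulDegree c I ≤ n → f I ∈ ℳ (n - koszulDegree c I)) ∧
        (¬ (I.card = i ∧ koszulDegree c I ≤ n) → f I = 0) := by
  rw [koszulComponent, Submodule.mem_pi]
  refine forall_congr' fun I => ?_
  by_cases h : I.card = i ∧ koszulDegree c I ≤ n
  · simp [h]
  · rw [if_neg h]
    simp [h]

omit [Module S M] [IsScalarTower A S M] in
theorem koszulComponent_eq_bot {r : ℕ} (c : Fin r → Fin d) {i : ℕ} (hi : r < i)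
    (n : Fin d → ℕ) : koszulComponent A ℳ c i n = ⊥ := by
  rw [eq_bot_iff]
  intro f hf
  rw [Submodule.mem_bot]
  ext I
  refine ((mem_koszulComponent ℳ).mp hf I).2 fun h => ?_
  have := I.card_le_univ
  rw [Fintype.card_fin] at this
  omega

theorem koszulBoundaries_eq_bot {r : ℕ} (x : Fin r → S) (c : Fin r → Fin d) {i : ℕ} (hi : r ≤ i)
    (n : Fin d → ℕ) : koszulBoundaries A ℳ x c i n = ⊥ := by
  rw [koszulBoundaries, koszulComponent_eq_bot ℳ c (Nat.lt_succ_of_le hi), Submodule.map_bot]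

omit [IsScalarTower A S M] in
theorem koszulDifferential_mem_component (𝒮 : (Fin d → ℕ) → Submodule A S)
    [SetLike.GradedSMul 𝒮 ℳ] {r : ℕ} {x : Fin r → S} {c : Fin r → Fin d}
    (hx : ∀ j, x j ∈ 𝒮 (Pi.single (c j) 1)) {i : ℕ} {n : Fin d → ℕ} {f : Finset (Fin r) → M}
    (hf : f ∈ koszulComponent A ℳ c (i + 1) n) :
    koszulDifferential x f ∈ koszulComponent A ℳ c i n := by
  rw [mem_koszulComponent] at hf ⊢
  intro J
  rw [koszulDifferential_apply]
  refine ⟨fun hJ => sum_mem fun j hj => ?_, fun hJ => Finset.sum_eq_zero fun j hj => ?_⟩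
  · have hjJ : j ∉ J := Finset.mem_compl.mp hj
    by_cases hc : (insert j J).card = i + 1 ∧ koszulDegree c (insert j J) ≤ n
    · have h := (hf (insert j J)).1 hc
      have hc2 := hc.2
      rw [koszulDegree_insert c hjJ] at hc2 h
      have hmem := smul_mem_graded (ℳ := ℳ) (hx j) h
      have hdeg : Pi.single (c j) 1 + (n - (koszulDegree c J + Pi.single (c j) 1)) =
          n - koszulDegree c J := by
        obtain ⟨b, rfl⟩ := exists_add_of_le hc2
        rw [add_tsub_cancel_left, add_assoc, add_tsub_cancel_left]
      rw [hdeg] at hmem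
      rw [mul_smul]
      rcases neg_one_pow_eq_or S (J.filter fun l => l < j).card with hs | hs
      · rw [hs, one_smul]
        exact hmem
      · rw [hs, neg_smul, one_smul]
        exact neg_mem hmem
    · rw [(hf (insert j J)).2 hc, smul_zero]
      exact zero_mem _
  · have hjJ : j ∉ J := Finset.mem_compl.mp hj
    rw [(hf (insert j J)).2 fun hc => hJ ?_, smul_zero]
    obtain ⟨hc1, hc2⟩ := hc
    rw [Finset.card_insert_of_notMem hjJ] at hc1
    rw [koszulDegree_insert c hjJ] at hc2
    exact ⟨by omega, le_self_add.trans hc2⟩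

omit [Algebra A S] [IsScalarTower A S M] in
theorem koszulDifferential_eq_zero_of_mem_zero {r : ℕ} (x : Fin r → S) (c : Fin r → Fin d)
    {n : Fin d → ℕ} {f : Finset (Fin r) → M} (hf : f ∈ koszulComponent A ℳ c 0 n) :
    koszulDifferential x f = 0 := by
  ext J
  rw [koszulDifferential_apply]
  refine Finset.sum_eq_zero fun j hj => ?_
  rw [((mem_koszulComponent ℳ).mp hf (insert j J)).2 fun h => by simp at h, smul_zero]

omit [Module S M] [IsScalarTower A S M] in
theorem length_pi_submodule {ι : Type*} [Fintype ι] (p : ι → Submodule A M) :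
    Module.length A (Submodule.pi Set.univ p) = ∑ j, Module.length A (p j) := by
  rw [← Module.length_pi_of_fintype]
  exact LinearEquiv.length_eq
    { toFun := fun f j => ⟨f.1 j, f.2 j (Set.mem_univ j)⟩
      invFun := fun f => ⟨fun j => f j, fun j _ => (f j).2⟩
      map_add' := fun _ _ => rfl
      map_smul' := fun _ _ => rfl
      left_inv := fun _ => rfl
      right_inv := fun _ => rfl }

omit [Module S M] [IsScalarTower A S M] in
theorem length_koszulComponent {r : ℕ} (c : Fin r → Fin d) (i : ℕ) {n : Fin d → ℕ}
    (hn : koszulDegree c Finset.univ ≤ n) :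
    Module.length A (koszulComponent A ℳ c i n) =
      ∑ I ∈ Finset.univ.filter fun I : Finset (Fin r) => I.card = i,
        Module.length A (ℳ (n - koszulDegree c I)) := by
  rw [koszulComponent, length_pi_submodule, Finset.sum_filter]
  refine Finset.sum_congr rfl fun I _ => ?_
  have hI : koszulDegree c I ≤ n :=
    (Finset.sum_le_sum_of_subset (Finset.subset_univ I)).trans hn
  by_cases h : I.card = i
  · rw [if_pos h, if_pos ⟨h, hI⟩]
  · rw [if_neg h, if_neg fun h' => h h'.1, Module.length_bot]

/-- Lengths in `0 → Z_{i+1} → K_{i+1} → B_i → 0`. -/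
theorem length_koszulComponent_succ {r : ℕ} (x : Fin r → S) (c : Fin r → Fin d) (i : ℕ)
    (n : Fin d → ℕ) :
    Module.length A (koszulComponent A ℳ c (i + 1) n) =
      Module.length A (koszulCycles A ℳ x c (i + 1) n) +
        Module.length A (koszulBoundaries A ℳ x c i n) :=
  length_eq_inf_ker_add_map ((koszulDifferential x).restrictScalars A)
    (koszulComponent A ℳ c (i + 1) n)

theorem length_koszulComponent_zero {r : ℕ} (x : Fin r → S) (c : Fin r → Fin d)
    (n : Fin d → ℕ) :
    Module.length A (koszulComponent A ℳ c 0 n) =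
      Module.length A (koszulCycles A ℳ x c 0 n) := by
  have h : koszulCycles A ℳ x c 0 n = koszulComponent A ℳ c 0 n :=
    inf_eq_left.mpr fun f hf => koszulDifferential_eq_zero_of_mem_zero ℳ x c hf
  rw [h]

theorem length_eq_submodule_add_quotient {V : Type*} [AddCommGroup V] [Module A V]
    {B Z : Submodule A V} (h : B ≤ Z) :
    Module.length A Z = Module.length A B + Module.length A (Z ⧸ B.submoduleOf Z) := by
  rw [Module.length_eq_add_of_exact (B.submoduleOf Z).subtype (Submodule.mkQ _)
    (Submodule.subtype_injective _) (Submodule.mkQ_surjective _)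
    (LinearMap.exact_subtype_mkQ _), (Submodule.submoduleOfEquivOfLe h).length_eq]

/-- Lengths in `0 → B_i → Z_i → H_i → 0`. -/
theorem length_koszulCycles (𝒮 : (Fin d → ℕ) → Submodule A S)
    [SetLike.GradedSMul 𝒮 ℳ] {r : ℕ} {x : Fin r → S}
    {c : Fin r → Fin d} (hx : ∀ j, x j ∈ 𝒮 (Pi.single (c j) 1)) (i : ℕ) (n : Fin d → ℕ) :
    Module.length A (koszulCycles A ℳ x c i n) =
      Module.length A (koszulBoundaries A ℳ x c i n) +
        Module.length A (KoszulHomology A ℳ x c i n) := by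
  refine length_eq_submodule_add_quotient ?_
  rintro _ ⟨f, hf, rfl⟩
  exact ⟨koszulDifferential_mem_component ℳ 𝒮 hx hf, koszulDifferential_comp_self x f⟩

/-- The Euler characteristic of a finite complex with components of length `κ i`, boundaries of
length `β i` and homology of length `η i`. -/
theorem alternating_sum_homology {κ β η : ℕ → ℤ} (h0 : κ 0 = β 0 + η 0)
    (h1 : ∀ i, κ (i + 1) = β (i + 1) + η (i + 1) + β i) (t : ℕ) :
    ∑ i ∈ Finset.range (t + 1), (-1) ^ i * η i =
      ∑ i ∈ Finset.range (t + 1), (-1) ^ i * κ i - (-1) ^ t * β t := by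
  induction t with
  | zero => simp [h0]
  | succ t ih =>
    rw [Finset.sum_range_succ, ih, Finset.sum_range_succ _ (t + 1), h1, pow_succ]
    ring

section FiniteLength

variable (𝒮 : (Fin d → ℕ) → Submodule A S) [SetLike.GradedSMul 𝒮 ℳ]
  (hfin : ∀ n, Module.length A (ℳ n) ≠ ⊤) {r : ℕ} {x : Fin r → S}
  {c : Fin r → Fin d} (hx : ∀ j, x j ∈ 𝒮 (Pi.single (c j) 1)) {n : Fin d → ℕ}
  (hn : koszulDegree c Finset.univ ≤ n)
include 𝒮 hfin hx hn

omit hx [SetLike.GradedSMul 𝒮 ℳ] 𝒮 in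
variable (x) in
theorem length_koszulCycles_ne_top (i : ℕ) :
    Module.length A (koszulCycles A ℳ x c i n) ≠ ⊤ := by
  have hK : ∀ i, Module.length A (koszulComponent A ℳ c i n) ≠ ⊤ := fun i => by
    rw [length_koszulComponent ℳ c i hn]
    exact (WithTop.sum_ne_top).mpr fun I _ => hfin _
  intro h
  cases i with
  | zero => exact hK 0 ((length_koszulComponent_zero ℳ x c n).trans h)
  | succ i => exact hK (i + 1) (by rw [length_koszulComponent_succ ℳ x, h, top_add])

theorem length_koszulHomology_ne_top (i : ℕ) :
    Module.length A (KoszulHomology A ℳ x c i n) ≠ ⊤ := fun h =>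
  length_koszulCycles_ne_top ℳ hfin x hn i (by rw [length_koszulCycles ℳ 𝒮 hx, h, add_top])

/-- The alternating sum of the lengths of the homology of the Koszul complex is the alternating sum
of the lengths of its components. -/
theorem koszulEulerFunction_eq :
    koszulEulerFunction A ℳ x c n =
      ∑ I : Finset (Fin r), (-1) ^ I.card * hilbertFun A ℳ (n - koszulDegree c I) := by
  have hZ := length_koszulCycles_ne_top ℳ hfin x hn
  have hH := length_koszulHomology_ne_top ℳ 𝒮 hfin hx hn
  have h2 := fun i => length_koszulCycles ℳ 𝒮 hx i n
  have hB : ∀ i, Module.length A (koszulBoundaries A ℳ x c i n) ≠ ⊤ := fun i h =>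
    hZ i (by rw [h2, h, top_add])
  have e0 : ((Module.length A (koszulComponent A ℳ c 0 n)).toNat : ℤ) =
      (Module.length A (koszulBoundaries A ℳ x c 0 n)).toNat +
        (Module.length A (KoszulHomology A ℳ x c 0 n)).toNat := by
    rw [length_koszulComponent_zero ℳ x, h2, ENat.toNat_add (hB 0) (hH 0), Nat.cast_add]
  have e1 : ∀ i, ((Module.length A (koszulComponent A ℳ c (i + 1) n)).toNat : ℤ) =
      (Module.length A (koszulBoundaries A ℳ x c (i + 1) n)).toNat +
        (Module.length A (KoszulHomology A ℳ x c (i + 1) n)).toNat +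
        (Module.length A (koszulBoundaries A ℳ x c i n)).toNat := fun i => by
    rw [length_koszulComponent_succ ℳ x, ENat.toNat_add (hZ _) (hB i), h2,
      ENat.toNat_add (hB _) (hH _), Nat.cast_add, Nat.cast_add]
  have hsum := alternating_sum_homology
    (κ := fun i => ((Module.length A (koszulComponent A ℳ c i n)).toNat : ℤ))
    (β := fun i => ((Module.length A (koszulBoundaries A ℳ x c i n)).toNat : ℤ))
    (η := fun i => ((Module.length A (KoszulHomology A ℳ x c i n)).toNat : ℤ)) e0 e1 r
  rw [koszulEulerFunction, hsum, koszulBoundaries_eq_bot ℳ x c le_rfl, Module.length_bot]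
  rw [ENat.toNat_zero, Nat.cast_zero, mul_zero, sub_zero]
  rw [← Finset.sum_fiberwise_of_maps_to (t := Finset.range (r + 1)) (g := Finset.card)
    (fun I _ => by
      rw [Finset.mem_range, Nat.lt_succ_iff]
      simpa using I.card_le_univ)]
  refine Finset.sum_congr rfl fun i _ => ?_
  rw [length_koszulComponent ℳ c i hn, ENat.toNat_sum fun I _ => hfin _, Nat.cast_sum,
    Finset.mul_sum]
  exact Finset.sum_congr rfl fun I hI => by rw [(Finset.mem_filter.mp hI).2]; rfl

end FiniteLength

/-- An alternating sum of shifted values of a numerical polynomial over all subsets is an iterated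
backward difference. -/
theorem EventuallyBinomial.alternating_sum {f : (Fin d → ℕ) → ℤ} {e : (Fin d → ℕ) →₀ ℤ}
    (hf : EventuallyBinomial f e) {r : ℕ} (c : Fin r → Fin d) (T : Finset (Fin r)) :
    EventuallyBinomial (fun n => ∑ I ∈ T.powerset, (-1) ^ I.card * f (n - koszulDegree c I))
      (coeffShift (koszulDegree c T) e) := by
  induction T using Finset.induction_on with
  | empty => simpa [koszulDegree, coeffShift_zero] using hf
  | insert j T hj ih =>
    rw [koszulDegree_insert c hj, add_comm, ← coeffShift_coeffShift]
    refine (ih.backwardDiff (c j)).congr (Eventually.of_forall fun n => ?_)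
    rw [Finset.sum_powerset_insert hj, MixedMult.backwardDiff, sub_eq_add_neg,
      ← Finset.sum_neg_distrib]
    congr 1
    refine Finset.sum_congr rfl fun I hI => ?_
    have hjI : j ∉ I := fun h => hj (Finset.mem_powerset.mp hI h)
    rw [Finset.card_insert_of_notMem hjI, koszulDegree_insert c hjI, pow_succ, tsub_tsub,
      add_comm (koszulDegree c I)]
    ring

/-- If `e(M; h) = 0` for all `h > k`, where `k` is the type of `x`, then `χ(x, M)` is well defined
and equal to `e(M; k)`. -/
theorem eulerChar_eq (𝒮 : (Fin d → ℕ) → Submodule A S)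
    [SetLike.GradedSMul 𝒮 ℳ] (hfin : ∀ n, Module.length A (ℳ n) ≠ ⊤) {r : ℕ} {x : Fin r → S}
    {c : Fin r → Fin d} (hx : ∀ j, x j ∈ 𝒮 (Pi.single (c j) 1)) {e : (Fin d → ℕ) →₀ ℤ}
    (he : EventuallyBinomial (hilbertFun A ℳ) e)
    (hzero : ∀ h, koszulDegree c Finset.univ < h → e h = 0) :
    EulerCharDefined A ℳ x c ∧ eulerChar A ℳ x c = e (koszulDegree c Finset.univ) := by
  have hn := eventually_ge_atTop (koszulDegree c Finset.univ)
  have hs : coeffShift (koszulDegree c Finset.univ) e =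
      Finsupp.single 0 (e (koszulDegree c Finset.univ)) := by
    classical
    ext h
    rw [coeffShift_apply, Finsupp.single_apply]
    split_ifs with h0
    · rw [← h0, zero_add]
    · refine hzero _ (lt_of_le_of_ne le_add_self fun h' => h0 ?_)
      exact (add_eq_right.mp h'.symm).symm
  have hconst : ∀ᶠ n in atTop,
      koszulEulerFunction A ℳ x c n = e (koszulDegree c Finset.univ) := by
    have h1 := he.alternating_sum c Finset.univ
    rw [hs] at h1
    filter_upwards [h1, hn] with n h2 h3
    rw [koszulEulerFunction_eq ℳ 𝒮 hfin hx h3]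
    simpa using h2
  exact ⟨⟨hn.mono fun n h => length_koszulHomology_ne_top ℳ 𝒮 hfin hx h, _, hconst⟩,
    eventualValue_eq hconst⟩

end Koszul

/-! ### The Hilbert polynomial as a multivariate polynomial -/

section Polynomial

variable {d : ℕ}

theorem eval_binomialPolynomial (k n : Fin d → ℕ) :
    MvPolynomial.eval (fun i => (n i : ℚ)) (binomialPolynomial k) = (binomialValue k n : ℚ) := by
  rw [binomialPolynomial, binomialValue, map_prod, Int.cast_prod]
  refine Finset.prod_congr rfl fun i _ => ?_
  have h : ∏ j ∈ Finset.range (k i), ((n i : ℚ) + ((j : ℚ) + 1)) =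
      ((k i).factorial : ℚ) * ((n i + k i).choose (k i) : ℚ) := by
    rw [← Nat.cast_mul, ← Nat.ascFactorial_eq_factorial_mul_choose, Nat.ascFactorial_eq_prod_range,
      Nat.cast_prod]
    refine Finset.prod_congr rfl fun j _ => ?_
    push_cast
    ring
  simp only [map_mul, map_prod, map_add, MvPolynomial.eval_C, MvPolynomial.eval_X]
  rw [h, ← mul_assoc, inv_mul_cancel₀ (by exact_mod_cast (k i).factorial_ne_zero), one_mul]
  norm_cast

theorem IsBinomialExpansion.eval_eq {P : MvPolynomial (Fin d) ℚ} {e : (Fin d → ℕ) →₀ ℤ}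
    (h : IsBinomialExpansion P e) (n : Fin d → ℕ) :
    MvPolynomial.eval (fun i => (n i : ℚ)) P = (binomialSum e n : ℚ) := by
  have hP : P = e.sum fun k a => MvPolynomial.C (a : ℚ) * binomialPolynomial k := h
  rw [hP, binomialSum, Finsupp.sum, Finsupp.sum, map_sum, Int.cast_sum]
  refine Finset.sum_congr rfl fun k _ => ?_
  rw [map_mul, MvPolynomial.eval_C, eval_binomialPolynomial, Int.cast_mul]

/-- Polynomials that agree at all large integral points are equal. -/
theorem eq_of_eventually_eval_eq {P Q : MvPolynomial (Fin d) ℚ}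
    (h : ∀ᶠ n : Fin d → ℕ in atTop, MvPolynomial.eval (fun i => (n i : ℚ)) P =
      MvPolynomial.eval (fun i => (n i : ℚ)) Q) : P = Q := by
  obtain ⟨n₀, hn₀⟩ := eventually_ge_vector h
  refine MvPolynomial.funext_set (fun i => (fun m : ℕ => (m : ℚ)) '' Set.Ici (n₀ i))
    (fun i => (Set.Ici_infinite (n₀ i)).image Nat.cast_injective.injOn) fun y hy => ?_
  have hy' : ∀ i, ∃ m : ℕ, n₀ i ≤ m ∧ (m : ℚ) = y i := fun i => hy i (Set.mem_univ i)
  choose m hm hmy using hy'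
  obtain rfl : (fun i => (m i : ℚ)) = y := funext hmy
  exact hn₀ m hm

variable {A : Type u} {M : Type w} [CommRing A] [AddCommGroup M] [Module A M]
  {ℳ : (Fin d → ℕ) → Submodule A M}

theorem hilbertPolynomial_spec (hfin : ∀ n, Module.length A (ℳ n) ≠ ⊤)
    {e : (Fin d → ℕ) →₀ ℤ} (he : EventuallyBinomial (hilbertFun A ℳ) e) :
    IsHilbertPolynomial A ℳ (hilbertPolynomial A ℳ) ∧
      IsBinomialExpansion (hilbertPolynomial A ℳ) (hilbertCoeff A ℳ) ∧
      EventuallyBinomial (hilbertFun A ℳ) (hilbertCoeff A ℳ) := by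
  let P : MvPolynomial (Fin d) ℚ :=
    e.sum fun k a => MvPolynomial.C (a : ℚ) * binomialPolynomial k
  have hPe : IsBinomialExpansion P e := rfl
  have hex : ∃ P, IsHilbertPolynomial A ℳ P := by
    refine ⟨P, he.mono fun n hn => ⟨hfin n, ?_⟩⟩
    rw [hPe.eval_eq, ← hn, hilbertFun, Int.cast_natCast]
  have hspec : IsHilbertPolynomial A ℳ (hilbertPolynomial A ℳ) := by
    rw [hilbertPolynomial, dif_pos hex]
    exact hex.choose_spec
  have hPeq : hilbertPolynomial A ℳ = P := by
    refine eq_of_eventually_eval_eq ?_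
    filter_upwards [hspec, he] with n h1 h2
    rw [← h1.2, hPe.eval_eq, ← h2, hilbertFun, Int.cast_natCast]
  have hex' : ∃ e, IsBinomialExpansion (hilbertPolynomial A ℳ) e := ⟨e, hPeq ▸ hPe⟩
  have hspec' : IsBinomialExpansion (hilbertPolynomial A ℳ) (hilbertCoeff A ℳ) := by
    rw [hilbertCoeff, dif_pos hex']
    exact hex'.choose_spec
  refine ⟨hspec, hspec', hspec.mono fun n hn => ?_⟩
  have h := hn.2.trans (hspec'.eval_eq n)
  rw [hilbertFun]
  exact_mod_cast h

end Polynomial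

/-! ### Types of mixed multiplicity systems -/

section System

variable {d : ℕ} {A : Type u} {S : Type v} {M : Type w} [CommRing A] [CommRing S] [Algebra A S]
  [AddCommGroup M] [Module S M] [Module.Finite S M]
  (𝒮 : (Fin d → ℕ) → Submodule A S) [GradedAlgebra 𝒮]

theorem koszulDegree_univ_eq_iff {r : ℕ} (c : Fin r → Fin d) (k : Fin d → ℕ) :
    koszulDegree c Finset.univ = k ↔
      ∀ i, (Finset.univ.filter fun j => c j = i).card = k i := by
  rw [funext_iff]
  refine forall_congr' fun i => ?_
  rw [koszulDegree, Finset.sum_apply, Finset.card_filter]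
  simp only [Pi.single_apply, eq_comm]

theorem isMixedMultiplicitySystem_iff {r : ℕ} (x : Fin r → S) (c : Fin r → Fin d)
    (k : Fin d → ℕ) :
    IsMixedMultiplicitySystem 𝒮 M x c k ↔
      (∀ j, x j ∈ 𝒮 (Pi.single (c j) 1)) ∧ koszulDegree c Finset.univ = k ∧
        RelevantDimNonpos 𝒮 (Module.annihilator S M ⊔ Ideal.span (Set.range x)) := by
  rw [IsMixedMultiplicitySystem, dimRelevantSupport_quotient_nonpos_iff, koszulDegree_univ_eq_iff]

end System

end MixedMult
end

theorem theorem2p00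
    {d : ℕ} (hd : 0 < d)
    {A : Type*} [CommRing A] [IsLocalRing A] [IsArtinianRing A]
    [Infinite (IsLocalRing.ResidueField A)]
    {S : Type*} [CommRing S] [Algebra A S]
    (𝒮 : (Fin d → ℕ) → Submodule A S) [GradedAlgebra 𝒮] (hS : MixedMult.IsStandardGraded 𝒮)
    {M : Type*} [AddCommGroup M] [Module A M] [Module S M] [IsScalarTower A S M]
    [Module.Finite S M]
    (ℳ : (Fin d → ℕ) → Submodule A M) [DirectSum.Decomposition ℳ] [SetLike.GradedSMul 𝒮 ℳ]
    (k : Fin d → ℕ) :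
    -- the Hilbert polynomial exists and has an expansion with integer coefficients `e(M; h)`
    MixedMult.IsHilbertPolynomial A ℳ (MixedMult.hilbertPolynomial A ℳ) ∧
    MixedMult.IsBinomialExpansion (MixedMult.hilbertPolynomial A ℳ)
      (MixedMult.hilbertCoeff A ℳ) ∧
    -- `e(M; k)` is defined iff there is a mixed multiplicity system of the type `k`
    (MixedMult.MixedMultiplicityDefined A ℳ k ↔
      ∃ (r : ℕ) (x : Fin r → S) (c : Fin r → Fin d),
        MixedMult.IsMixedMultiplicitySystem 𝒮 M x c k) ∧
    -- and then `χ(x, M) = ẽ(x, M) = e(M; k)` for every such system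
    ∀ (r : ℕ) (x : Fin r → S) (c : Fin r → Fin d),
      MixedMult.IsMixedMultiplicitySystem 𝒮 M x c k →
        MixedMult.EulerCharDefined A ℳ x c ∧
        MixedMult.MixedSymbolDefined A r x M ℳ ∧
        MixedMult.eulerChar A ℳ x c = MixedMult.mixedSymbol A r x M ℳ ∧
        MixedMult.mixedSymbol A r x M ℳ = MixedMult.hilbertCoeff A ℳ k := by
  have hfin := hS.length_ne_top ℳ
  obtain ⟨e, he⟩ := hS.exists_eventuallyBinomial ℳ
  obtain ⟨hP, hexp, hbin⟩ := MixedMult.hilbertPolynomial_spec hfin he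
  refine ⟨hP, hexp, ⟨fun h => ?_, ?_⟩, fun r x c hx => ?_⟩
  · obtain ⟨r, x, c, hx⟩ := hS.exists_system _ M ℳ _ k rfl hbin h
    exact ⟨r, x, c, (MixedMult.isMixedMultiplicitySystem_iff 𝒮 x c k).mpr hx⟩
  · rintro ⟨r, x, c, hx⟩
    obtain ⟨hmem, rfl, hdim⟩ := (MixedMult.isMixedMultiplicitySystem_iff 𝒮 x c k).mp hx
    exact (hS.mixedSymbol_eq r x c M ℳ _ hmem hdim hbin).2.2
  · obtain ⟨hmem, rfl, hdim⟩ := (MixedMult.isMixedMultiplicitySystem_iff 𝒮 x c k).mp hx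
    obtain ⟨hdef, hval, hzero⟩ := hS.mixedSymbol_eq r x c M ℳ _ hmem hdim hbin
    obtain ⟨hχ, hχval⟩ := MixedMult.eulerChar_eq ℳ 𝒮 hfin hmem hbin hzero
    exact ⟨hχ, hdef, hχval.trans hval.symm, hval⟩
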